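/- Let $q\in\mathbb C$ with $0<|q|<1$. Let $C(U_q(2))$ be the universal unital $C^*$-algebra generated by $a,b,D$ with relations $ba=qab$, $a^*b=qba^*$, $bb^*=b^*b$, $aa^*+bb^*=1$, $aD=Da$, $bD=q^2|q|^{-2}Db$, $DD^*=D^*D=1$, $a^*a+|q|^2b^*b=1$, with comultiplication $\Delta(a)=a\otimes a-\bar q\,b\otimes Db^*$, $\Delta(b)=a\otimes b+b\otimes Da^*$, $\Delta(D)=D\otimes D$. Let $h$ be its Haar state, that is, the state with $(h\otimes\mathrm{id})\Delta(x)=h(x)1=(\mathrm{id}\otimes h)\Delta(x)$ for all $x$ in the $*$-algebra $\mathcal O(U_q(2))$ generated by $a,b,D$, and let $L^2(h)$ be its GNS space, on which $x\in C(U_q(2))$ acts through the GNS representation, written $x\triangleright v$. Put $c=-\bar q Db^*$, $d=Da^*$, $|n|_{x}=\frac{x^{n}-x^{-n}}{x-x^{-1}}$, and let $\binom nk_{x}$ be the Gaussian binomial coefficient, $\binom nk_x=\prod_{s=1}^{k}\frac{1-x^{n-k+s}}{1-x^{s}}$. For $\ell\in\frac12\mathbb N$, $i,j\in\{-\ell,-\ell+1,\dots,\ell\}$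 and $k\in\mathbb Z$ put $$t^\ell_{i,j}=\sum_{\substack{m+n=\ell-i\\0\le m\le\ell-j\\0\le n\le\ell+j}}q^{n(\ell-j-m)}\frac{\binom{2\ell}{\ell+j}_{|q|^2}^{1/2}}{\binom{2\ell}{\ell+i}_{|q|^2}^{1/2}}\binom{\ell-j}{m}_{|q|^2}\binom{\ell+j}{n}_{|q|^2}a^mc^{\ell-j-m}b^nd^{\ell+j-n},$$ $$e^\ell_{i,j,k}=|q|^{-i}\sqrt{|2\ell+1|_{|q|}}\;t^\ell_{i,j}(D^*)^k\in L^2(h),$$ and put $e^{\ell}_{i,j,k}=0$ for all other indices (terms containing such a vector are absent). Write $\sqrt{q/\bar q}$ for $q/|q|$, i.e. for $e^{\sqrt{-1}\,\pi\theta}$ if $q=|q|e^{\sqrt{-1}\,\pi\theta}$. Then the vectors $e^\ell_{i,j,k}$ ($\ell\in\frac12\mathbb N$, $i,j\in\{-\ell,\dots,\ell\}$, $k\in\mathbb Z$) form an orthonormal basis of $L^2(h)$, and the generators act on it by (i) $D\triangleright e^\ell_{i,j,k}=(q/\bar q)^{i-j}e^\ell_{i,j,k-1}$; (ii) $D^*\triangleright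 e^\ell_{i,j,k}=(\bar q/q)^{i-j}e^\ell_{i,j,k+1}$; (iii) $b\triangleright e^\ell_{i,j,k}=\beta_+(\ell,i,j)\,e^{\ell+1/2}_{i-1/2,j+1/2,k}+\beta_-(\ell,i,j)\,e^{\ell-1/2}_{i-1/2,j+1/2,k-1}$; (iv) $b^*\triangleright e^\ell_{i,j,k}=\beta^+_+(\ell,i,j)\,e^{\ell+1/2}_{i+1/2,j-1/2,k+1}+\beta^+_-(\ell,i,j)\,e^{\ell-1/2}_{i+1/2,j-1/2,k}$; (v) $a\triangleright e^\ell_{i,j,k}=\alpha_+(\ell,i,j)\,e^{\ell+1/2}_{i-1/2,j-1/2,k}+\alpha_-(\ell,i,j)\,e^{\ell-1/2}_{i-1/2,j-1/2,k-1}$; (vi) $a^*\triangleright e^\ell_{i,j,k}=\alpha^+_+(\ell,i,j)\,e^{\ell+1/2}_{i+1/2,j+1/2,k+1}+\alpha^+_-(\ell,i,j)\,e^{\ell-1/2}_{i+1/2,j+1/2,k}$; where $$\beta_+=q^{\ell-j}\sqrt{\tfrac{(1-|q|^{2(\ell+j+1)})(1-|q|^{2(\ell-i+1)})}{(1-|q|^{2(2\ell+1)})(1-|q|^{2(2\ell+2)})}},\qquad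 \beta_-=-q^{\ell-j-1}\bar q^{\,j-i+1}\sqrt{\tfrac q{\bar q}}\sqrt{\tfrac{(1-|q|^{2(\ell-j)})(1-|q|^{2(\ell+i)})}{(1-|q|^{2(2\ell)})(1-|q|^{2(2\ell+1)})}},$$ $$\beta^+_+=-q^{j-i-1}\bar q^{\,\ell-j+1}\sqrt{\tfrac q{\bar q}}\sqrt{\tfrac{(1-|q|^{2(\ell-j+1)})(1-|q|^{2(\ell+i+1)})}{(1-|q|^{2(2\ell+1)})(1-|q|^{2(2\ell+2)})}},\qquad \beta^+_-=\bar q^{\,\ell-j}\sqrt{\tfrac{(1-|q|^{2(\ell+j)})(1-|q|^{2(\ell-i)})}{(1-|q|^{2(2\ell)})(1-|q|^{2(2\ell+1)})}},$$ $$\alpha_+=\sqrt{\tfrac{(1-|q|^{2(\ell-j+1)})(1-|q|^{2(\ell-i+1)})}{(1-|q|^{2(2\ell+1)})(1-|q|^{2(2\ell+2)})}},\qquad \alpha_-=q^{\ell-j}\bar q^{\,\ell-i+1}\sqrt{\tfrac q{\bar q}}\sqrt{\tfrac{(1-|q|^{2(\ell+j)})(1-|q|^{2(\ell+i)})}{(1-|q|^{2(2\ell)})(1-|q|^{2(2\ell+1)})}},$$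 $$\alpha^+_+=q^{\ell-i}\bar q^{\,\ell-j+1}\sqrt{\tfrac q{\bar q}}\sqrt{\tfrac{(1-|q|^{2(\ell+j+1)})(1-|q|^{2(\ell+i+1)})}{(1-|q|^{2(2\ell+1)})(1-|q|^{2(2\ell+2)})}},\qquad \alpha^+_-=\sqrt{\tfrac{(1-|q|^{2(\ell-j)})(1-|q|^{2(\ell-i)})}{(1-|q|^{2(2\ell)})(1-|q|^{2(2\ell+1)})}}.$$ (For $\ell=0$ the coefficients with subscript $-$ are not needed, since their vectors are $0$.) -/

import Mathlib

open scoped TensorProduct ComplexOrder ENNReal ComplexConjugate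

noncomputable section

namespace Uq2

/-! ## The universal C*-algebra `C(U_q(2))` -/

/-- The defining relations of `C(U_q(2))` for elements `a, b, D` of a complex *-algebra. -/
structure Relations (q : ℂ) {B : Type*} [Ring B] [StarRing B] [Algebra ℂ B] (a b D : B) :
    Prop where
  ba : b * a = q • (a * b)
  as_b : star a * b = q • (b * star a)
  b_bs : b * star b = star b * b
  a_as : a * star a + b * star b = 1
  aD : a * D = D * a
  bD : b * D = (q ^ 2 * ((‖q‖ : ℂ) ^ 2)⁻¹) • (D * b)
  D_Ds : D * star D = 1
  Ds_D : star D * D = 1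
  as_a : star a * a + ((‖q‖ : ℂ) ^ 2) • (star b * b) = 1

/-- A realisation of the relations in a nonzero unital C*-algebra. -/
structure Realization (q : ℂ) : Type 1 where
  carrier : Type
  [cstar : CStarAlgebra carrier]
  [nontriv : Nontrivial carrier]
  a : carrier
  b : carrier
  D : carrier
  rel : Relations q a b D

instance (q : ℂ) (ρ : Realization q) : CStarAlgebra ρ.carrier := ρ.cstar

instance (q : ℂ) (ρ : Realization q) : Nontrivial ρ.carrier := ρ.nontriv

theorem norm_le_one_of_sum {B : Type*} [CStarAlgebra B] {x y : B}
    (h : x * star x + y * star y = 1) : ‖x‖ ≤ 1 ∧ ‖y‖ ≤ 1 := by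
  let _ : PartialOrder B := CStarAlgebra.spectralOrder B
  have _ : StarOrderedRing B := CStarAlgebra.spectralOrderedRing B
  have key : ∀ u v : B, u * star u + v * star v = 1 → ‖u‖ ≤ 1 := by
    intro u v huv
    have h1 : u * star u ≤ 1 := by
      rw [← huv]
      exact le_add_of_nonneg_right (mul_star_self_nonneg v)
    have h2 := (CStarAlgebra.norm_le_one_iff_of_nonneg _ (mul_star_self_nonneg u)).2 h1
    rw [CStarRing.norm_self_mul_star] at h2
    nlinarith [norm_nonneg u]
  exact ⟨key x y h, key y x (by rw [add_comm]; exact h)⟩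

/-- The product (of bounded families) of all realisations. -/
abbrev Big (q : ℂ) : Type 1 := lp (fun ρ : Realization q => ρ.carrier) ∞

instance (q : ℂ) : CStarAlgebra (Big q) where

/-- A bounded family, as an element of the product. -/
def mkBig (q : ℂ) (f : ∀ ρ : Realization q, ρ.carrier) (hf : ∀ ρ, ‖f ρ‖ ≤ 1) : Big q :=
  ⟨f, memℓp_infty ⟨1, by rintro _ ⟨ρ, rfl⟩; exact hf ρ⟩⟩

def bigA (q : ℂ) : Big q := mkBig q (fun ρ => ρ.a) fun ρ => (norm_le_one_of_sum ρ.rel.a_as).1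

def bigB (q : ℂ) : Big q := mkBig q (fun ρ => ρ.b) fun ρ => (norm_le_one_of_sum ρ.rel.a_as).2

def bigD (q : ℂ) : Big q := mkBig q (fun ρ => ρ.D) fun ρ =>
  (norm_le_one_of_sum (x := ρ.D) (y := 0) (by simp [ρ.rel.D_Ds])).1

/-- The C*-subalgebra of the product generated by the universal `a, b, D`. -/
def univSub (q : ℂ) : StarSubalgebra ℂ (Big q) :=
  (StarAlgebra.adjoin ℂ {bigA q, bigB q, bigD q}).topologicalClosure

instance (q : ℂ) : IsClosed (univSub q : Set (Big q)) :=
  StarSubalgebra.isClosed_topologicalClosure _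

/-- `C(U_q(2))`: the universal unital C*-algebra on `a, b, D` subject to the relations, i.e. the
completion of the *-algebra in the supremum of the norms of all its realisations (see
`exists_unique_lift` for the universal property). -/
def CUq2 (q : ℂ) : Type 1 := univSub q

instance (q : ℂ) : CStarAlgebra (CUq2 q) := inferInstanceAs (CStarAlgebra (univSub q))

instance (q : ℂ) : PartialOrder (CUq2 q) := CStarAlgebra.spectralOrder (CUq2 q)

instance (q : ℂ) : StarOrderedRing (CUq2 q) := CStarAlgebra.spectralOrderedRing (CUq2 q)

theorem mem_univSub (q : ℂ) {x : Big q} (hx : x ∈ ({bigA q, bigB q, bigD q} : Set (Big q))) :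
    x ∈ univSub q :=
  StarSubalgebra.le_topologicalClosure _ (StarAlgebra.subset_adjoin ℂ _ hx)

/-- The generators of `C(U_q(2))`. -/
def gA (q : ℂ) : CUq2 q := (⟨bigA q, mem_univSub q (by simp)⟩ : univSub q)

def gB (q : ℂ) : CUq2 q := (⟨bigB q, mem_univSub q (by simp)⟩ : univSub q)

def gD (q : ℂ) : CUq2 q := (⟨bigD q, mem_univSub q (by simp)⟩ : univSub q)

/-- Evaluation of `C(U_q(2))` at a realisation. -/
def evalHom (q : ℂ) (ρ : Realization q) : CUq2 q →⋆ₐ[ℂ] ρ.carrier where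
  toFun x := (x : univSub q).1 ρ
  map_one' := rfl
  map_mul' _ _ := rfl
  map_zero' := rfl
  map_add' _ _ := rfl
  commutes' _ := rfl
  map_star' _ := rfl

theorem ext_eval (q : ℂ) {x y : CUq2 q} (h : ∀ ρ, evalHom q ρ x = evalHom q ρ y) : x = y :=
  Subtype.ext (Subtype.ext (funext h))

theorem relations_gen (q : ℂ) : Relations q (gA q) (gB q) (gD q) := by
  have ea : ∀ ρ, evalHom q ρ (gA q) = ρ.a := fun _ => rfl
  have eb : ∀ ρ, evalHom q ρ (gB q) = ρ.b := fun _ => rfl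
  have ed : ∀ ρ, evalHom q ρ (gD q) = ρ.D := fun _ => rfl
  constructor <;> refine ext_eval q fun ρ => ?_ <;>
    simp only [map_mul, map_add, map_smul, map_star, map_one, ea, eb, ed]
  exacts [ρ.rel.ba, ρ.rel.as_b, ρ.rel.b_bs, ρ.rel.a_as, ρ.rel.aD, ρ.rel.bD, ρ.rel.D_Ds,
    ρ.rel.Ds_D, ρ.rel.as_a]

/-- Two *-homomorphisms out of `C(U_q(2))` that agree on the generators are equal. -/
theorem hom_ext (q : ℂ) {B : Type*} [CStarAlgebra B] {φ ψ : CUq2 q →⋆ₐ[ℂ] B}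
    (ha : φ (gA q) = ψ (gA q)) (hb : φ (gB q) = ψ (gB q)) (hd : φ (gD q) = ψ (gD q)) :
    φ = ψ := by
  have hc : ∀ χ : CUq2 q →⋆ₐ[ℂ] B, Continuous χ := fun χ =>
    AddMonoidHomClass.continuous_of_bound χ 1 fun x => by
      simpa using NonUnitalStarAlgHom.norm_apply_le (χ : CUq2 q →⋆ₙₐ[ℂ] B) x
  refine StarAlgHom.ext_topologicalClosure
    (S := StarAlgebra.adjoin ℂ {bigA q, bigB q, bigD q}) (hc φ) (hc ψ) ?_
  refine StarAlgHom.ext_adjoin ?_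
  rintro ⟨_, hx⟩ (rfl | rfl | rfl)
  exacts [ha, hb, hd]

/-- The universal property of `C(U_q(2))`. -/
theorem exists_unique_lift (q : ℂ) {B : Type} [CStarAlgebra B] {a b D : B}
    (h : Relations q a b D) :
    ∃! φ : CUq2 q →⋆ₐ[ℂ] B, φ (gA q) = a ∧ φ (gB q) = b ∧ φ (gD q) = D := by
  have huniq : ∀ φ ψ : CUq2 q →⋆ₐ[ℂ] B,
      (φ (gA q) = a ∧ φ (gB q) = b ∧ φ (gD q) = D) →
      (ψ (gA q) = a ∧ ψ (gB q) = b ∧ ψ (gD q) = D) → φ = ψ := by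
    rintro φ ψ ⟨h1, h2, h3⟩ ⟨h4, h5, h6⟩
    exact hom_ext q (h1.trans h4.symm) (h2.trans h5.symm) (h3.trans h6.symm)
  suffices hex : ∃ φ : CUq2 q →⋆ₐ[ℂ] B, φ (gA q) = a ∧ φ (gB q) = b ∧ φ (gD q) = D by
    obtain ⟨φ, hφ⟩ := hex
    exact ⟨φ, hφ, fun ψ hψ => huniq ψ φ hψ hφ⟩
  rcases subsingleton_or_nontrivial B with hB | hB
  · exact ⟨{ toFun := fun _ => 0
             map_one' := Subsingleton.elim _ _
             map_mul' := fun _ _ => Subsingleton.elim _ _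
             map_zero' := rfl
             map_add' := fun _ _ => Subsingleton.elim _ _
             commutes' := fun _ => Subsingleton.elim _ _
             map_star' := fun _ => Subsingleton.elim _ _ },
      Subsingleton.elim _ _, Subsingleton.elim _ _, Subsingleton.elim _ _⟩
  · exact ⟨evalHom q ⟨B, a, b, D, h⟩, rfl, rfl, rfl⟩

/-! ## The Hopf algebra `O(U_q(2))` and the Haar state -/

/-- The letters `a, a*, b, b*, D, D*`. -/
inductive Letter
  | a | as | b | bs | D | Ds

/-- The free algebra on the six letters. -/
abbrev Words : Type := FreeAlgebra ℂ Letter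

/-- A letter as an element of the free algebra. -/
abbrev lt (x : Letter) : Words := FreeAlgebra.ι ℂ x

open Letter in
/-- The defining relations of `U_q(2)` together with their adjoints. -/
inductive PolyRel (q : ℂ) : Words → Words → Prop
  | ba : PolyRel q (lt b * lt a) (q • (lt a * lt b))
  | as_bs : PolyRel q (lt as * lt bs) (conj q • (lt bs * lt as))
  | as_b : PolyRel q (lt as * lt b) (q • (lt b * lt as))
  | bs_a : PolyRel q (lt bs * lt a) (conj q • (lt a * lt bs))
  | b_bs : PolyRel q (lt b * lt bs) (lt bs * lt b)
  | a_as : PolyRel q (lt a * lt as + lt b * lt bs) 1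
  | aD : PolyRel q (lt a * lt D) (lt D * lt a)
  | Ds_as : PolyRel q (lt Ds * lt as) (lt as * lt Ds)
  | bD : PolyRel q (lt b * lt D) ((q ^ 2 * ((‖q‖ : ℂ) ^ 2)⁻¹) • (lt D * lt b))
  | Ds_bs : PolyRel q (lt Ds * lt bs)
      ((conj q ^ 2 * ((‖q‖ : ℂ) ^ 2)⁻¹) • (lt bs * lt Ds))
  | D_Ds : PolyRel q (lt D * lt Ds) 1
  | Ds_D : PolyRel q (lt Ds * lt D) 1
  | as_a : PolyRel q (lt as * lt a + ((‖q‖ : ℂ) ^ 2) • (lt bs * lt b)) 1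

/-- The coordinate algebra `O(U_q(2))`: the *-algebra presented by `a, b, D` and the relations,
written as the algebra on the letters and their adjoints. -/
abbrev Poly (q : ℂ) : Type := RingQuot (PolyRel q)

/-- The class of a letter in `O(U_q(2))`. -/
def g (q : ℂ) (x : Letter) : Poly q := RingQuot.mkAlgHom ℂ (PolyRel q) (lt x)

/-- The values of the canonical map `O(U_q(2)) → C(U_q(2))` on the letters. -/
def toCLetter (q : ℂ) : Letter → CUq2 q
  | .a => gA q
  | .as => star (gA q)
  | .b => gB q
  | .bs => star (gB q)
  | .D => gD q
  | .Ds => star (gD q)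

/-- The canonical map `O(U_q(2)) → C(U_q(2))`. -/
def toC (q : ℂ) : Poly q →ₐ[ℂ] CUq2 q :=
  RingQuot.liftAlgHom ℂ ⟨FreeAlgebra.lift ℂ (toCLetter q), by
    have R := relations_gen q
    intro x y hxy
    cases hxy <;>
      simp only [map_mul, map_add, map_smul, map_one, FreeAlgebra.lift_ι_apply, toCLetter]
    · exact R.ba
    · simpa using congrArg star R.ba
    · exact R.as_b
    · simpa using congrArg star R.as_b
    · exact R.b_bs
    · exact R.a_as
    · exact R.aD
    · simpa using congrArg star R.aD
    · exact R.bD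
    · simpa using congrArg star R.bD
    · exact R.D_Ds
    · exact R.Ds_D
    · exact R.as_a⟩

open Letter in
/-- The values of the comultiplication on the letters. -/
def comulLetter (q : ℂ) : Letter → Poly q ⊗[ℂ] Poly q
  | .a => g q a ⊗ₜ g q a + (-conj q) • (g q b ⊗ₜ (g q D * g q bs))
  | .as => g q as ⊗ₜ g q as + (-q) • (g q bs ⊗ₜ (g q b * g q Ds))
  | .b => g q a ⊗ₜ g q b + g q b ⊗ₜ (g q D * g q as)
  | .bs => g q as ⊗ₜ g q bs + g q bs ⊗ₜ (g q a * g q Ds)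
  | .D => g q D ⊗ₜ g q D
  | .Ds => g q Ds ⊗ₜ g q Ds

section relations

open Letter

variable (q : ℂ)

theorem g_rel {x y : Words} (h : PolyRel q x y) :
    RingQuot.mkAlgHom ℂ (PolyRel q) x = RingQuot.mkAlgHom ℂ (PolyRel q) y :=
  RingQuot.mkAlgHom_rel ℂ h

theorem g_ba : g q b * g q a = q • (g q a * g q b) := by
  simpa [g] using g_rel q .ba
theorem g_as_bs : g q as * g q bs = conj q • (g q bs * g q as) := by
  simpa [g] using g_rel q .as_bs
theorem g_as_b : g q as * g q b = q • (g q b * g q as) := by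
  simpa [g] using g_rel q .as_b
theorem g_bs_a : g q bs * g q a = conj q • (g q a * g q bs) := by
  simpa [g] using g_rel q .bs_a
theorem g_bs_b : g q bs * g q b = g q b * g q bs := by
  simpa [g] using (g_rel q .b_bs).symm
theorem g_a_as : g q a * g q as = 1 + (-1 : ℂ) • (g q b * g q bs) := by
  have h : g q a * g q as + g q b * g q bs = 1 := by simpa [g] using g_rel q .a_as
  rw [← h]; module
theorem g_aD : g q a * g q D = g q D * g q a := by
  simpa [g] using g_rel q .aD
theorem g_asDs : g q as * g q Ds = g q Ds * g q as := by
  simpa [g] using (g_rel q .Ds_as).symm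
theorem g_bD : g q b * g q D = (q ^ 2 * ((‖q‖ : ℂ) ^ 2)⁻¹) • (g q D * g q b) := by
  simpa [g] using g_rel q .bD
theorem g_Ds_bs :
    g q Ds * g q bs = (conj q ^ 2 * ((‖q‖ : ℂ) ^ 2)⁻¹) • (g q bs * g q Ds) := by
  simpa [g] using g_rel q .Ds_bs
theorem g_D_Ds : g q D * g q Ds = 1 := by simpa [g] using g_rel q .D_Ds
theorem g_Ds_D : g q Ds * g q D = 1 := by simpa [g] using g_rel q .Ds_D
theorem g_as_a : g q as * g q a = 1 + (-(‖q‖ : ℂ) ^ 2) • (g q b * g q bs) := by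
  have h : g q as * g q a + ((‖q‖ : ℂ) ^ 2) • (g q b * g q bs) = 1 := by
    rw [← g_bs_b]; simpa [g] using g_rel q .as_a
  rw [← h]; module

theorem assoc_of {x y z : Poly q} (h : x * y = z) (w : Poly q) : x * (y * w) = z * w := by
  rw [← mul_assoc, h]

theorem g_asD : g q as * g q D = g q D * g q as := by
  calc g q as * g q D = g q D * (g q Ds * g q as) * g q D := by
        rw [← mul_assoc, g_D_Ds, one_mul]
    _ = g q D * g q as := by rw [← g_asDs, mul_assoc, mul_assoc, g_Ds_D, mul_one]

theorem g_aDs : g q a * g q Ds = g q Ds * g q a := by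
  calc g q a * g q Ds = g q Ds * (g q D * g q a) * g q Ds := by
        rw [← mul_assoc, g_Ds_D, one_mul]
    _ = g q Ds * g q a := by rw [← g_aD, mul_assoc, mul_assoc, g_D_Ds, mul_one]

theorem g_bsD : g q bs * g q D = (conj q ^ 2 * ((‖q‖ : ℂ) ^ 2)⁻¹) • (g q D * g q bs) := by
  calc g q bs * g q D = g q D * (g q Ds * g q bs) * g q D := by
        rw [← mul_assoc, g_D_Ds, one_mul]
    _ = _ := by
      rw [g_Ds_bs, mul_smul_comm, smul_mul_assoc, mul_assoc, mul_assoc, g_Ds_D, mul_one]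

variable {q}

theorem norm_sq_eq (q : ℂ) : (‖q‖ : ℂ) ^ 2 = q * conj q := by
  rw [Complex.mul_conj, Complex.normSq_eq_norm_sq]; norm_cast

theorem phase_mul (hq : q ≠ 0) :
    (conj q ^ 2 * ((‖q‖ : ℂ) ^ 2)⁻¹) * (q ^ 2 * ((‖q‖ : ℂ) ^ 2)⁻¹) = 1 := by
  have : conj q ≠ 0 := (map_ne_zero _).2 hq
  rw [norm_sq_eq]; field_simp

theorem g_bDs (hq : q ≠ 0) :
    g q b * g q Ds = (conj q ^ 2 * ((‖q‖ : ℂ) ^ 2)⁻¹) • (g q Ds * g q b) := by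
  have h : g q Ds * g q b = (q ^ 2 * ((‖q‖ : ℂ) ^ 2)⁻¹) • (g q b * g q Ds) := by
    calc g q Ds * g q b = g q Ds * (g q b * g q D) * g q Ds := by
          rw [mul_assoc, mul_assoc, g_D_Ds, mul_one]
      _ = _ := by
        rw [g_bD, mul_smul_comm, smul_mul_assoc, ← mul_assoc, g_Ds_D, one_mul]
  rw [h, smul_smul, phase_mul hq, one_smul]

theorem g_bsDs (hq : q ≠ 0) :
    g q bs * g q Ds = (q ^ 2 * ((‖q‖ : ℂ) ^ 2)⁻¹) • (g q Ds * g q bs) := by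
  rw [g_Ds_bs, smul_smul, mul_comm, phase_mul hq, one_smul]

theorem g_b_zero (hq : q = 0) : g q b = 0 := by
  have h := congrArg (· * g q Ds) (g_bD q)
  simpa [mul_assoc, g_D_Ds, hq] using h

theorem g_bs_zero (hq : q = 0) : g q bs = 0 := by
  have h := congrArg (· * g q Ds) (g_bsD q)
  simpa [mul_assoc, g_D_Ds, hq] using h

end relations

set_option linter.unusedSimpArgs false in
/-- The comultiplication is compatible with the relations. -/
theorem comul_rel (q : ℂ) {x y : Words} (h : PolyRel q x y) :
    FreeAlgebra.lift ℂ (comulLetter q) x = FreeAlgebra.lift ℂ (comulLetter q) y := by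
  by_cases hq : q = 0
  · cases h <;>
    simp [comulLetter, Algebra.TensorProduct.one_def, g_b_zero hq, g_bs_zero hq, g_D_Ds, g_Ds_D,
      g_aD, g_asDs, g_a_as, g_as_a]
  have hc : conj q ≠ 0 := (map_ne_zero _).2 hq
  cases h <;>
    simp only [map_mul, map_add, map_smul, map_one, FreeAlgebra.lift_ι_apply, comulLetter,
      Algebra.TensorProduct.one_def]
  all_goals simp only [Algebra.TensorProduct.tmul_mul_tmul, mul_assoc, g_ba, g_as_bs, g_as_b,
      g_bs_a, g_bs_b, g_a_as, g_aD, g_asDs, g_bD, g_D_Ds, g_Ds_D, g_as_a, g_asD, g_aDs, g_bsD,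
      g_bDs hq, g_bsDs hq,
      assoc_of q (g_ba q), assoc_of q (g_as_bs q), assoc_of q (g_as_b q), assoc_of q (g_bs_a q),
      assoc_of q (g_bs_b q), assoc_of q (g_a_as q), assoc_of q (g_aD q), assoc_of q (g_asDs q),
      assoc_of q (g_bD q), assoc_of q (g_D_Ds q), assoc_of q (g_Ds_D q),
      assoc_of q (g_as_a q), assoc_of q (g_asD q), assoc_of q (g_aDs q), assoc_of q (g_bsD q),
      assoc_of q (g_bDs hq), assoc_of q (g_bsDs hq), mul_add, add_mul, smul_mul_assoc,
      mul_smul_comm, one_mul, mul_one, TensorProduct.tmul_add, TensorProduct.add_tmul,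
      TensorProduct.tmul_smul, ← TensorProduct.smul_tmul', smul_add, smul_smul, norm_sq_eq]
  all_goals match_scalars <;> field_simp <;> ring

/-- The comultiplication `Δ : O(U_q(2)) → O(U_q(2)) ⊗ O(U_q(2))`,
`Δ(a) = a ⊗ a - q̄ b ⊗ D b*`, `Δ(b) = a ⊗ b + b ⊗ D a*`, `Δ(D) = D ⊗ D`. -/
def comul (q : ℂ) : Poly q →ₐ[ℂ] Poly q ⊗[ℂ] Poly q :=
  RingQuot.liftAlgHom ℂ ⟨FreeAlgebra.lift ℂ (comulLetter q), fun _ _ h => comul_rel q h⟩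

/-- The restriction of a functional on `C(U_q(2))` to `O(U_q(2))`. -/
def restr (q : ℂ) (h : CUq2 q →ₚ[ℂ] ℂ) : Poly q →ₗ[ℂ] ℂ :=
  h.toLinearMap ∘ₗ (toC q).toLinearMap

/-- `h` is the Haar state of `U_q(2)`: a state that is invariant from both sides,
`(h ⊗ id)Δ(x) = h(x) 1 = (id ⊗ h)Δ(x)`. -/
structure IsHaarState (q : ℂ) (h : CUq2 q →ₚ[ℂ] ℂ) : Prop where
  map_one : h 1 = 1
  left_invariant : ∀ x : Poly q,
    TensorProduct.lid ℂ (Poly q) ((restr q h).rTensor (Poly q) (comul q x)) = restr q h x • 1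
  right_invariant : ∀ x : Poly q,
    TensorProduct.rid ℂ (Poly q) ((restr q h).lTensor (Poly q) (comul q x)) = restr q h x • 1

/-! ## The vectors `e^ℓ_{i,j,k}`

The half-integers `ℓ, i, j` are represented by the integers `L = 2ℓ`, `I = 2i`, `J = 2j`. -/

/-- `ℓ ∈ ½ℕ` and `i, j ∈ {-ℓ, -ℓ + 1, …, ℓ}`. -/
def IsIndex (L I J : ℤ) : Prop :=
  |I| ≤ L ∧ |J| ≤ L ∧ Even (L - I) ∧ Even (L - J)

/-- The `x`-factorial `∏_{s=1}^{n} (1 - x^s) / (1 - x)`. -/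
def qFactorial (x : ℝ) (n : ℕ) : ℝ := ∏ s ∈ Finset.range n, (1 - x ^ (s + 1)) / (1 - x)

/-- The Gaussian binomial coefficient `(n choose k)_x` (for `k ≤ n`). -/
def qBinomial (x : ℝ) (n k : ℕ) : ℝ :=
  qFactorial x n / (qFactorial x k * qFactorial x (n - k))

/-- The symmetric `x`-number `|n|_x = (x^n - x^{-n}) / (x - x^{-1})`. -/
def qNumber (x : ℝ) (n : ℤ) : ℝ := (x ^ n - x ^ (-n)) / (x - x⁻¹)

/-- `c = -q̄ D b*`. -/
def cElem (q : ℂ) : CUq2 q := (-conj q) • (gD q * star (gB q))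

/-- `d = D a*`. -/
def dElem (q : ℂ) : CUq2 q := gD q * star (gA q)

/-- `(D*)^k = D^{-k}` for an integer `k`. -/
def dStarPow (q : ℂ) (k : ℤ) : CUq2 q :=
  if 0 ≤ k then star (gD q) ^ k.toNat else gD q ^ (-k).toNat

/-- The matrix coefficient `t^ℓ_{i,j}`; here `P = ℓ - j`, `R = ℓ + j`, and the sum runs over
`m + n = ℓ - i`, `m ≤ ℓ - j`, `n ≤ ℓ + j`. -/
def matCoeff (q : ℂ) (L I J : ℤ) : CUq2 q :=
  let P : ℕ := ((L - J) / 2).toNat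
  let R : ℕ := ((L + J) / 2).toNat
  ∑ p ∈ (Finset.HasAntidiagonal.antidiagonal ((L - I) / 2).toNat).filter (fun p => p.1 ≤ P ∧ p.2 ≤ R),
    (q ^ (p.2 * (P - p.1)) *
      ((√(qBinomial (‖q‖ ^ 2) L.toNat R) /
          √(qBinomial (‖q‖ ^ 2) L.toNat ((L + I) / 2).toNat) *
        qBinomial (‖q‖ ^ 2) P p.1 * qBinomial (‖q‖ ^ 2) R p.2 : ℝ) : ℂ)) •
      (gA q ^ p.1 * cElem q ^ (P - p.1) * gB q ^ p.2 * dElem q ^ (R - p.2))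

open Classical in
/-- The element `|q|^{-i} √|2ℓ+1|_{|q|} t^ℓ_{i,j} (D*)^k` of `C(U_q(2))`, and `0` by convention if
`(ℓ, i, j)` is not an admissible index. -/
def eElem (q : ℂ) (L I J k : ℤ) : CUq2 q :=
  if IsIndex L I J then
    ((‖q‖ ^ (-(I : ℝ) / 2) * √(qNumber ‖q‖ (L + 1)) : ℝ) : ℂ) • (matCoeff q L I J * dStarPow q k)
  else 0

/-- The vector `e^ℓ_{i,j,k}` in the GNS Hilbert space `L²(h)`. -/
def eVec (q : ℂ) (h : CUq2 q →ₚ[ℂ] ℂ) (L I J k : ℤ) : h.GNS :=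
  ((h.toPreGNS (eElem q L I J k) : h.PreGNS) : h.GNS)

/-- The admissible indices `(ℓ, i, j, k)`. -/
def Index : Type := {p : ℤ × ℤ × ℤ × ℤ // IsIndex p.1 p.2.1 p.2.2.1}

/-- The family of all `e^ℓ_{i,j,k}` with admissible indices. -/
def eFamily (q : ℂ) (h : CUq2 q →ₚ[ℂ] ℂ) (p : Index) : h.GNS :=
  eVec q h p.1.1 p.1.2.1 p.1.2.2.1 p.1.2.2.2

/-! ## The coefficients -/

/-- `√(q / q̄)`, the square root `e^{√-1 π θ}` for `q = |q| e^{√-1 π θ}`. -/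
def phase (q : ℂ) : ℂ := q / ‖q‖

/-- `√((1 - |q|^u) (1 - |q|^v) / ((1 - |q|^w) (1 - |q|^{w + 2})))`. -/
def root (q : ℂ) (u v w : ℤ) : ℂ :=
  ((√((1 - ‖q‖ ^ u) * (1 - ‖q‖ ^ v) / ((1 - ‖q‖ ^ w) * (1 - ‖q‖ ^ (w + 2)))) : ℝ) : ℂ)

/-- `β₊(ℓ, i, j)`; all coefficients are functions of `L = 2ℓ`, `I = 2i`, `J = 2j`. -/
def betaPlus (q : ℂ) (L I J : ℤ) : ℂ :=
  q ^ ((L - J) / 2) * root q (L + J + 2) (L - I + 2) (2 * L + 2)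

/-- `β₋(ℓ, i, j)` -/
def betaMinus (q : ℂ) (L I J : ℤ) : ℂ :=
  -q ^ ((L - J) / 2 - 1) * conj q ^ ((J - I) / 2 + 1) * phase q * root q (L - J) (L + I) (2 * L)

/-- `β₊⁺(ℓ, i, j)` -/
def betaPlusStar (q : ℂ) (L I J : ℤ) : ℂ :=
  -q ^ ((J - I) / 2 - 1) * conj q ^ ((L - J) / 2 + 1) * phase q *
    root q (L - J + 2) (L + I + 2) (2 * L + 2)

/-- `β₋⁺(ℓ, i, j)` -/
def betaMinusStar (q : ℂ) (L I J : ℤ) : ℂ :=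
  conj q ^ ((L - J) / 2) * root q (L + J) (L - I) (2 * L)

/-- `α₊(ℓ, i, j)` -/
def alphaPlus (q : ℂ) (L I J : ℤ) : ℂ := root q (L - J + 2) (L - I + 2) (2 * L + 2)

/-- `α₋(ℓ, i, j)` -/
def alphaMinus (q : ℂ) (L I J : ℤ) : ℂ :=
  q ^ ((L - J) / 2) * conj q ^ ((L - I) / 2 + 1) * phase q * root q (L + J) (L + I) (2 * L)

/-- `α₊⁺(ℓ, i, j)` -/
def alphaPlusStar (q : ℂ) (L I J : ℤ) : ℂ :=
  q ^ ((L - I) / 2) * conj q ^ ((L - J) / 2 + 1) * phase q *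
    root q (L + J + 2) (L + I + 2) (2 * L + 2)

/-- `α₋⁺(ℓ, i, j)` -/
def alphaMinusStar (q : ℂ) (L I J : ℤ) : ℂ := root q (L - J) (L - I) (2 * L)

end Uq2

end

noncomputable section

namespace Uq2

/-! ## The quantum plane coaction -/

/-! Let x, y be quantum plane variables with yx = q xy, commuting with the algebra, and put ξ = xa +
yc, η = xb + yd. Then ηξ = q ξη, and D is the quantum determinant of the matrix (a b; c d). With P =
ℓ - j, R = ℓ + j, s = ℓ - i, M = ℓ + i, the coefficient of x^s y^M in ξ^P η^R is `coact q P R s`, a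
scalar multiple of t^ℓ_{i,j}. The q-binomial theorem gives its expansion, because (yc)(xa) = |q|²
(xa)(yc) and (yd)(xb) = |q|² (xb)(yd) (`coact_eq_sum`, `matCoeff_eq`).

Action formulas. Multiplication by a generator is a Clebsch–Gordan decomposition of ½ ⊗ ℓ. An extra
factor ξ or η raises the degree (`raise_left`, `raise_right`), while the determinant pairing lowers
it (`lower_left`, `lower_right`). For each column these are two linear equations for two products.
Solving them gives `a_mul_coact`, `b_mul_coact`, `c_mul_coact`, `d_mul_coact`, and a* = D*d, b* =
-D*c/q̄ give the adjoints. The normalisation makes the coefficients symmetric square roots.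

Haar state. An upper triangular representation ρ of O(U_q(2)) on ℂ² turns invariance into h([(id ⊗
ρ)Δ(x)]_{ij}) = h(x) δ_{ij} (`haar_shift`). The corner entry replaces an η by a ξ, so h kills every
coefficient with P > 0. The diagonal entry multiplies the remaining ones by torus characters, so h
kills those too, except multiples of 1. No Peter–Weyl theory and no formula for h on monomials is
needed.

Orthonormality is an induction on ℓ. If x is one of a, a*, b, b*, then x e^ℓ is a combination of one
vector of spin ℓ + ½ and one of spin ℓ - ½, so inner products with e^{ℓ+1/2} reduce to those at ℓ
and ℓ - ½ by moving x to the other side as x* (`haarInner_raise`). The result is a Kronecker delta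
because the coefficients of x and x* are conjugate. For ℓ = 0 the vectors are powers of D and h is
known.

Totality: by the action formulas the span of the e^ℓ_{i,j,k} is stable under left multiplication by
O(U_q(2)), and it contains 1. It therefore contains the whole dense algebra. -/

/-- The element `c = -q̄ D b*` of `O(U_q(2))`. -/
def polyC (q : ℂ) : Poly q := (-conj q) • (g q .D * g q .bs)

/-- The element `d = D a*` of `O(U_q(2))`. -/
def polyD (q : ℂ) : Poly q := g q .D * g q .as

/-- The element `D b b*`. -/
def polyY (q : ℂ) : Poly q := g q .D * (g q .b * g q .bs)

/-- The number `(1 - |q|^{2n}) / (1 - |q|²)`. -/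
def qNum (q : ℂ) (n : ℤ) : ℂ := (1 - (q * conj q) ^ n) / (1 - q * conj q)

/-! ### Quadratic relations between a, b, c, d and the quantum determinant D. -/

section quadratic

variable {q : ℂ}

theorem conj_ne_zero' (hq : q ≠ 0) : conj q ≠ 0 := (map_ne_zero _).2 hq

theorem one_sub_ne_zero (hq1 : ‖q‖ < 1) : 1 - q * conj q ≠ 0 := by
  rw [← norm_sq_eq]
  have h : ‖q‖ ^ 2 < 1 := by nlinarith [norm_nonneg q]
  intro h0
  have : (1 : ℝ) - ‖q‖ ^ 2 = 0 := by exact_mod_cast h0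
  linarith

theorem ca_eq : polyC q * g q .a = conj q • (g q .a * polyC q) := by
  simp only [polyC, smul_mul_assoc, mul_smul_comm, mul_assoc, g_bs_a, assoc_of q (g_aD q)]
  module

theorem db_eq (hq : q ≠ 0) : polyD q * g q .b = conj q • (g q .b * polyD q) := by
  have := conj_ne_zero' hq
  simp only [polyD, mul_smul_comm, smul_mul_assoc, mul_assoc, g_as_b, assoc_of q (g_bD q)]
  match_scalars
  rw [norm_sq_eq]; field_simp

theorem dc_eq (hq : q ≠ 0) : polyD q * polyC q = q • (polyC q * polyD q) := by
  have := conj_ne_zero' hq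
  simp only [polyC, polyD, mul_smul_comm, smul_mul_assoc, mul_assoc, g_as_bs,
    assoc_of q (g_bsD q), assoc_of q (g_asD q)]
  match_scalars
  rw [norm_sq_eq]; field_simp

/-- In this and the next three lemmas the mixed products are reduced to D and Y = D b b*. Together
they say that D = ad - q⁻¹bc = da - q cb is the quantum determinant. -/
theorem bc_eq (hq : q ≠ 0) : g q .b * polyC q = (-q) • polyY q := by
  have := conj_ne_zero' hq
  simp only [polyC, polyY, mul_smul_comm, smul_mul_assoc, mul_assoc, assoc_of q (g_bD q)]
  match_scalars
  rw [norm_sq_eq]; field_simp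

theorem cb_eq : polyC q * g q .b = (-conj q) • polyY q := by
  simp only [polyC, polyY, smul_mul_assoc, mul_assoc, g_bs_b]

theorem ad_eq : g q .a * polyD q = g q .D - polyY q := by
  simp only [polyD, polyY, assoc_of q (g_aD q), mul_assoc, g_a_as, mul_add, mul_one,
    mul_smul_comm]
  module

theorem da_eq : polyD q * g q .a = g q .D - (q * conj q) • polyY q := by
  simp only [polyD, polyY, mul_assoc, g_as_a, mul_add, mul_one, mul_smul_comm, norm_sq_eq]
  module

theorem bD_eq (hq : q ≠ 0) : g q .b * g q .D = (q / conj q) • (g q .D * g q .b) := by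
  have := conj_ne_zero' hq
  rw [g_bD, norm_sq_eq]; congr 1; field_simp

theorem cD_eq (hq : q ≠ 0) : polyC q * g q .D = (conj q / q) • (g q .D * polyC q) := by
  have := conj_ne_zero' hq
  simp only [polyC, mul_smul_comm, smul_mul_assoc, mul_assoc, g_bsD]
  match_scalars
  rw [norm_sq_eq]; field_simp

theorem dD_eq : polyD q * g q .D = g q .D * polyD q := by
  simp only [polyD, mul_assoc, g_asD]

end quadratic

/-- Left multiplication of `∑ x^s y^{N-s} f(s)` by `x α + y β`, where `y x = q x y`. -/
def colStep (q : ℂ) (α β : Poly q) (f : ℤ → Poly q) (s : ℤ) : Poly q :=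
  α * f (s - 1) + q ^ s • (β * f s)

/-- The coefficient of `x^s y^{P+R-s}` in `(x a + y c)^P (x b + y d)^R`. -/
def coact (q : ℂ) (P R : ℕ) : ℤ → Poly q :=
  (colStep q (g q .a) (polyC q))^[P] ((colStep q (g q .b) (polyD q))^[R] (Pi.single 0 1))

/-! ### Recursions and lowering relations for the coefficients of ξ^P η^R. -/

section coact

variable {q : ℂ}

theorem coact_succ_left (P R : ℕ) (s : ℤ) : coact q (P + 1) R s =
    g q .a * coact q P R (s - 1) + q ^ s • (polyC q * coact q P R s) := by
  rw [coact, Function.iterate_succ_apply']; rfl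

theorem coact_zero_succ (R : ℕ) (s : ℤ) : coact q 0 (R + 1) s =
    g q .b * coact q 0 R (s - 1) + q ^ s • (polyD q * coact q 0 R s) := by
  simp only [coact, Function.iterate_zero, id, Function.iterate_succ_apply']; rfl

theorem coact_zero_zero (s : ℤ) : coact q 0 0 s = if s = 0 then 1 else 0 := by
  simp [coact, Pi.single_apply]

/-- Since ηξ = q ξη for ξ = xa + yc and η = xb + yd, a new factor η placed on the far left crosses
the P factors ξ at the cost of q^P. -/
theorem coact_succ_right (hq : q ≠ 0) (P R : ℕ) (s : ℤ) : q ^ P • coact q P (R + 1) s =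
    g q .b * coact q P R (s - 1) + q ^ s • (polyD q * coact q P R s) := by
  have hc := conj_ne_zero' hq
  induction P generalizing s with
  | zero => rw [pow_zero, one_smul, coact_zero_succ]
  | succ P ih =>
    have h1 := congrArg (g q .a * ·) (ih (s - 1))
    have h2 := congrArg (polyC q * ·) (ih s)
    simp only [mul_add, mul_smul_comm] at h1 h2
    have ab : g q .b * g q .a = q • (g q .a * g q .b) := g_ba q
    have e1 := assoc_of q ab
    have e2 := assoc_of q (dc_eq hq)
    simp only [coact_succ_left, mul_add, mul_smul_comm, e1, assoc_of q (da_eq (q := q)),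
      assoc_of q (bc_eq hq), e2, smul_mul_assoc, sub_mul]
    have e3 := fun w : Poly q => assoc_of q (ad_eq (q := q)) w
    have e4 := fun w : Poly q => assoc_of q (cb_eq (q := q)) w
    simp only [e3, e4, sub_mul, smul_mul_assoc] at h1 h2
    simp only [mul_assoc]
    rw [zpow_sub_one₀ hq] at h1
    linear_combination (norm := skip) q • h1 + (q * q ^ s) • h2
    rw [zpow_sub_one₀ hq]
    match_scalars <;> field_simp <;> ring

theorem qNum_zero : qNum q 0 = 0 := by simp [qNum]

theorem qNum_natCast (n : ℕ) : qNum q n = (1 - (q * conj q) ^ n) / (1 - q * conj q) := by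
  simp [qNum]

/-- The lowering relation for the first column. -/
theorem lower_left (hq : q ≠ 0) (hq1 : ‖q‖ < 1) (P R : ℕ) (s : ℤ) :
    (conj q ^ s * qNum q (P + R - s)) • (g q .a * coact q P R s) -
      ((conj q)⁻¹ * qNum q (s + 1)) • (polyC q * coact q P R (s + 1)) =
    (conj q ^ P * qNum q R) • (g q .D * coact q P (R - 1) s) := by
  have hc := conj_ne_zero' hq
  have hp := one_sub_ne_zero hq1
  induction P generalizing s with
  | zero =>
    induction R generalizing s with
    | zero =>
      simp only [coact_zero_zero, Nat.cast_zero, qNum_zero]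
      rcases eq_or_ne s 0 with rfl | h0
      · simp [qNum_zero]
      · rcases eq_or_ne s (-1) with rfl | h1
        · simp [qNum_zero]
        · have : s + 1 ≠ 0 := by omega
          simp [h0, this]
    | succ R ih =>
      -- The determinant arises in this case: ad and da each contribute D and a multiple of Y = D b
      -- b*, and the multiples of Y cancel against those from bc and cb.
      have h1 := congrArg (g q .b * ·) (ih (s - 1))
      have h2 := congrArg (polyD q * ·) (ih s)
      -- The truncated index `R - 1` is harmless at R = 0, where the factor `qNum q R` vanishes.
      have h3 : qNum q R • (g q .D * coact q 0 R s) = qNum q R • (g q .D *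
          (g q .b * coact q 0 (R - 1) (s - 1) + q ^ s • (polyD q * coact q 0 (R - 1) s))) := by
        rcases R with _ | R
        · simp [qNum_zero]
        · rw [coact_zero_succ]; simp
      simp only [coact_zero_succ, mul_add, mul_sub, mul_smul_comm, sub_add_cancel,
        add_sub_cancel_right, add_tsub_cancel_right, assoc_of q (g_ba q), assoc_of q (bc_eq hq),
        assoc_of q (da_eq (q := q)), assoc_of q (dc_eq hq), assoc_of q (ad_eq (q := q)),
        assoc_of q (cb_eq (q := q)), assoc_of q (bD_eq hq), assoc_of q (dD_eq (q := q)),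
        smul_mul_assoc, sub_mul, mul_assoc, pow_zero, one_mul] at h1 h2 h3 ⊢
      simp only [qNum] at h1 h2 h3 ⊢
      linear_combination (norm := skip) (conj q / q) • h1 + (q ^ s) • h2 - h3
      rw [zpow_sub_one₀ hc]
      push_cast
      simp only [mul_zpow, zpow_add₀ hq, zpow_add₀ hc, zpow_sub₀ hq, zpow_sub₀ hc, zpow_natCast,
        zpow_one, zpow_zero]
      match_scalars <;> field_simp <;> ring
  | succ P ih =>
    have h1 := congrArg (g q .a * ·) (ih (s - 1))
    have h2 := congrArg (polyC q * ·) (ih s)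
    simp only [coact_succ_left, mul_add, mul_sub, mul_smul_comm, sub_add_cancel,
      add_sub_cancel_right, assoc_of q (ca_eq (q := q)), smul_mul_assoc, mul_assoc,
      assoc_of q (g_aD q), assoc_of q (cD_eq hq)] at h1 h2 ⊢
    simp only [qNum] at h1 h2 ⊢
    linear_combination (norm := skip) conj q • h1 + (q * q ^ s) • h2
    rw [zpow_sub_one₀ hc]
    push_cast
    simp only [mul_zpow, zpow_add₀ hq, zpow_add₀ hc, zpow_sub₀ hq, zpow_sub₀ hc, zpow_natCast, zpow_one]
    match_scalars <;> field_simp <;> ring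

/-- The lowering relation for the second column. -/
theorem lower_right (hq : q ≠ 0) (hq1 : ‖q‖ < 1) (P R : ℕ) (s : ℤ) :
    (conj q ^ s * qNum q (P + R - s)) • (g q .b * coact q P R s) -
      ((conj q)⁻¹ * qNum q (s + 1)) • (polyD q * coact q P R (s + 1)) =
    (-(conj q)⁻¹ * qNum q P) • (g q .D * coact q (P - 1) R s) := by
  have hc := conj_ne_zero' hq
  have hp := one_sub_ne_zero hq1
  induction P generalizing s with
  | zero =>
    induction R generalizing s with
    | zero =>
      simp only [coact_zero_zero, Nat.cast_zero, qNum_zero]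
      rcases eq_or_ne s 0 with rfl | h0
      · simp [qNum_zero]
      · rcases eq_or_ne s (-1) with rfl | h1
        · simp [qNum_zero]
        · have : s + 1 ≠ 0 := by omega
          simp [h0, this]
    | succ R ih =>
      have h1 := congrArg (g q .b * ·) (ih (s - 1))
      have h2 := congrArg (polyD q * ·) (ih s)
      simp only [coact_zero_succ, mul_add, mul_sub, mul_smul_comm, sub_add_cancel,
        add_sub_cancel_right, assoc_of q (db_eq hq), Nat.cast_zero, qNum_zero, mul_zero,
        zero_smul, smul_mul_assoc, mul_assoc] at h1 h2 ⊢
      simp only [qNum] at h1 h2 ⊢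
      linear_combination (norm := skip) conj q • h1 + (q * q ^ s) • h2
      rw [zpow_sub_one₀ hc]
      push_cast
      simp only [mul_zpow, zpow_add₀ hq, zpow_add₀ hc, zpow_sub₀ hq, zpow_sub₀ hc, zpow_natCast,
        zpow_one, zpow_zero]
      match_scalars <;> field_simp <;> ring
  | succ P ih =>
    -- The columns have exchanged roles: here the factors ξ produce the determinant, whereas the
    -- induction on R only used db = q̄ bd.
    have h1 := congrArg (g q .a * ·) (ih (s - 1))
    have h2 := congrArg (polyC q * ·) (ih s)
    have h3 : qNum q P • (g q .D * coact q P R s) = qNum q P • (g q .D *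
        (g q .a * coact q (P - 1) R (s - 1) + q ^ s • (polyC q * coact q (P - 1) R s))) := by
      rcases P with _ | P
      · simp [qNum_zero]
      · rw [coact_succ_left]; simp
    simp only [coact_succ_left, mul_add, mul_sub, mul_smul_comm, sub_add_cancel,
      add_sub_cancel_right, add_tsub_cancel_right, assoc_of q (g_ba q), assoc_of q (bc_eq hq),
      assoc_of q (da_eq (q := q)), assoc_of q (dc_eq hq), assoc_of q (ad_eq (q := q)),
      assoc_of q (cb_eq (q := q)), assoc_of q (g_aD q), assoc_of q (cD_eq hq),
      smul_mul_assoc, sub_mul, mul_assoc] at h1 h2 h3 ⊢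
    simp only [qNum] at h1 h2 h3 ⊢
    linear_combination (norm := skip) (q * conj q) • h1 + (q ^ 2 * q ^ s) • h2 + q • h3
    rw [zpow_sub_one₀ hc]
    push_cast
    simp only [mul_zpow, zpow_add₀ hq, zpow_add₀ hc, zpow_sub₀ hq, zpow_sub₀ hc, zpow_natCast,
      zpow_one]
    match_scalars <;> field_simp <;> ring

end coact

/-! ### Support, commutation with D, and multiplication of the coefficients by the generators. -/

section coact

variable {q : ℂ}

theorem coact_eq_zero_of_neg (P R : ℕ) {s : ℤ} (hs : s < 0) : coact q P R s = 0 := by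
  induction P generalizing s with
  | zero =>
    induction R generalizing s with
    | zero => rw [coact_zero_zero, if_neg hs.ne]
    | succ R ih => rw [coact_zero_succ, ih hs, ih (by omega)]; simp
  | succ P ih => rw [coact_succ_left, ih hs, ih (by omega)]; simp

theorem coact_eq_zero_of_lt (P R : ℕ) {s : ℤ} (hs : P + R < s) : coact q P R s = 0 := by
  induction P generalizing s with
  | zero =>
    induction R generalizing s with
    | zero => rw [coact_zero_zero, if_neg (by simp at hs; omega)]
    | succ R ih =>
      push_cast at hs ih
      rw [coact_zero_succ, ih (by omega), ih (by omega)]; simp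
  | succ P ih =>
    push_cast at hs
    rw [coact_succ_left, ih (by omega), ih (by omega)]; simp

/-- Only b and c fail to commute with D, and their phases are inverse to each other. Every monomial
of `coact q P R s` has s - P more factors b than factors c. -/
theorem coact_mul_D (hq : q ≠ 0) (P R : ℕ) (s : ℤ) :
    coact q P R s * g q .D = (q / conj q) ^ (s - P) • (g q .D * coact q P R s) := by
  have hc := conj_ne_zero' hq
  have hd : q / conj q ≠ 0 := div_ne_zero hq hc
  induction P generalizing s with
  | zero =>
    induction R generalizing s with
    | zero =>
      rcases eq_or_ne s 0 with rfl | h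
      · simp [coact_zero_zero]
      · simp [coact_zero_zero, h]
    | succ R ih =>
      simp only [coact_zero_succ, add_mul, smul_mul_assoc, mul_assoc, ih, mul_smul_comm, mul_add,
        assoc_of q (bD_eq hq), assoc_of q (dD_eq (q := q))]
      rw [show s - 1 - ((0 : ℕ) : ℤ) = s - (0 : ℕ) - 1 by ring, zpow_sub_one₀ hd]
      match_scalars <;> field_simp
  | succ P ih =>
    simp only [coact_succ_left, add_mul, smul_mul_assoc, mul_assoc, ih, mul_smul_comm, mul_add,
      assoc_of q (g_aD q), assoc_of q (cD_eq hq)]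
    rw [show s - 1 - (P : ℤ) = s - (P + 1 : ℕ) by push_cast; ring,
      show s - (P : ℤ) = s - (P + 1 : ℕ) + 1 by push_cast; ring, zpow_add_one₀ hd]
    match_scalars <;> field_simp

theorem coact_mul_Ds (hq : q ≠ 0) (P R : ℕ) (s : ℤ) :
    coact q P R s * g q .Ds = (conj q / q) ^ (s - P) • (g q .Ds * coact q P R s) := by
  have hd : q / conj q ≠ 0 := div_ne_zero hq (conj_ne_zero' hq)
  have h := congrArg (g q .Ds * · * g q .Ds) (coact_mul_D hq P R s)
  simp only [mul_smul_comm, smul_mul_assoc, mul_assoc, g_D_Ds, mul_one,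
    assoc_of q (g_Ds_D q), one_mul] at h
  rw [h, smul_smul, ← mul_zpow, div_mul_div_cancel₀ hq, div_self (conj_ne_zero' hq), one_zpow,
    one_smul]

/-- Up to a unit this is the determinant of the linear system formed by a raising and a lowering
relation. It explains the factor [P + R + 1] in the product formulas below. -/
theorem qNum_split (hq : q ≠ 0) (hq1 : ‖q‖ < 1) (s N : ℤ) :
    qNum q (s + 1) + q ^ (s + 1) * conj q ^ (s + 1) * qNum q (N - s) = qNum q (N + 1) := by
  have hc := conj_ne_zero' hq
  have hp := one_sub_ne_zero hq1
  simp only [qNum, mul_zpow, zpow_add₀ hq, zpow_add₀ hc, zpow_sub₀ hq, zpow_sub₀ hc, zpow_one]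
  field_simp
  ring

theorem raise_left (P R : ℕ) (s : ℤ) : coact q (P + 1) R (s + 1) =
    g q .a * coact q P R s + q ^ (s + 1) • (polyC q * coact q P R (s + 1)) := by
  rw [coact_succ_left, add_sub_cancel_right]

theorem raise_right (hq : q ≠ 0) (P R : ℕ) (s : ℤ) : q ^ P • coact q P (R + 1) (s + 1) =
    g q .b * coact q P R s + q ^ (s + 1) • (polyD q * coact q P R (s + 1)) := by
  rw [coact_succ_right hq, add_sub_cancel_right]

/-- Cramer's rule: `raise_left` and `lower_left` are two equations in the products of a with the
coefficient at s and of c with the coefficient at s + 1. Here c is eliminated, in `c_mul_coact` a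
is. The second column is treated alike with `raise_right` and `lower_right`. -/
theorem a_mul_coact (hq : q ≠ 0) (hq1 : ‖q‖ < 1) (P R : ℕ) (s : ℤ) :
    qNum q (P + R + 1) • (g q .a * coact q P R s) =
      qNum q (s + 1) • coact q (P + 1) R (s + 1) +
      (q ^ (s + 1) * conj q ^ (P + 1) * qNum q R) • (g q .D * coact q P (R - 1) s) := by
  have hc := conj_ne_zero' hq
  have h1 := raise_left (q := q) P R s
  have h2 := lower_left hq hq1 P R s
  rw [← qNum_split hq hq1 s (P + R)]
  linear_combination (norm := skip) (-qNum q (s + 1)) • h1 + (q ^ (s + 1) * conj q) • h2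
  simp only [zpow_add_one₀ hc]
  match_scalars <;> field_simp <;> ring

theorem c_mul_coact (hq : q ≠ 0) (hq1 : ‖q‖ < 1) (P R : ℕ) (s : ℤ) :
    qNum q (P + R + 1) • (polyC q * coact q P R (s + 1)) =
      (conj q ^ (s + 1) * qNum q (P + R - s)) • coact q (P + 1) R (s + 1) -
      (conj q ^ (P + 1) * qNum q R) • (g q .D * coact q P (R - 1) s) := by
  have hc := conj_ne_zero' hq
  have h1 := raise_left (q := q) P R s
  have h2 := lower_left hq hq1 P R s
  rw [← qNum_split hq hq1 s (P + R)]
  linear_combination (norm := skip)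
    (-(conj q ^ (s + 1) * qNum q (P + R - s))) • h1 - conj q • h2
  simp only [zpow_add_one₀ hc]
  match_scalars <;> field_simp <;> ring

theorem b_mul_coact (hq : q ≠ 0) (hq1 : ‖q‖ < 1) (P R : ℕ) (s : ℤ) :
    qNum q (P + R + 1) • (g q .b * coact q P R s) =
      (q ^ P * qNum q (s + 1)) • coact q P (R + 1) (s + 1) -
      (q ^ (s + 1) * qNum q P) • (g q .D * coact q (P - 1) R s) := by
  have hc := conj_ne_zero' hq
  have h1 := raise_right hq P R s
  have h2 := lower_right hq hq1 P R s
  rw [← qNum_split hq hq1 s (P + R)]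
  linear_combination (norm := skip) (-qNum q (s + 1)) • h1 + (q ^ (s + 1) * conj q) • h2
  simp only [zpow_add_one₀ hc]
  match_scalars <;> field_simp <;> ring

theorem d_mul_coact (hq : q ≠ 0) (hq1 : ‖q‖ < 1) (P R : ℕ) (s : ℤ) :
    qNum q (P + R + 1) • (polyD q * coact q P R (s + 1)) =
      (q ^ P * conj q ^ (s + 1) * qNum q (P + R - s)) • coact q P (R + 1) (s + 1) +
      qNum q P • (g q .D * coact q (P - 1) R s) := by
  have hc := conj_ne_zero' hq
  have h1 := raise_right hq P R s
  have h2 := lower_right hq hq1 P R s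
  rw [← qNum_split hq hq1 s (P + R)]
  linear_combination (norm := skip)
    (-(conj q ^ (s + 1) * qNum q (P + R - s))) • h1 - conj q • h2
  simp only [zpow_add_one₀ hc]
  match_scalars <;> field_simp <;> ring

theorem as_eq : g q .as = g q .Ds * polyD q := by
  rw [polyD, assoc_of q (g_Ds_D q), one_mul]

theorem bs_eq (hq : q ≠ 0) : g q .bs = (-(conj q)⁻¹) • (g q .Ds * polyC q) := by
  have hc := conj_ne_zero' hq
  rw [polyC, mul_smul_comm, assoc_of q (g_Ds_D q), one_mul, smul_smul]
  simp [hc]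

/-- As a* = D*d, this is the formula for d at s - 1 multiplied by D*, which cancels the D of the
lowered term. -/
theorem as_mul_coact (hq : q ≠ 0) (hq1 : ‖q‖ < 1) (P R : ℕ) (s : ℤ) :
    qNum q (P + R + 1) • (g q .as * coact q P R s) =
      (q ^ P * conj q ^ s * qNum q (P + R - s + 1)) • (g q .Ds * coact q P (R + 1) s) +
      qNum q P • coact q (P - 1) R (s - 1) := by
  have h := congrArg (g q .Ds * ·) (d_mul_coact hq hq1 P R (s - 1))
  simp only [sub_add_cancel, mul_add, mul_smul_comm, assoc_of q (g_Ds_D q), one_mul] at h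
  rw [as_eq, mul_assoc, h, show (P + R - (s - 1) : ℤ) = P + R - s + 1 by ring]

theorem bs_mul_coact (hq : q ≠ 0) (hq1 : ‖q‖ < 1) (P R : ℕ) (s : ℤ) :
    qNum q (P + R + 1) • (g q .bs * coact q P R s) =
      (-(conj q ^ (s - 1) * qNum q (P + R - s + 1))) • (g q .Ds * coact q (P + 1) R s) +
      (conj q ^ P * qNum q R) • coact q P (R - 1) (s - 1) := by
  have hc := conj_ne_zero' hq
  have h := congrArg (g q .Ds * ·) (c_mul_coact hq hq1 P R (s - 1))
  simp only [sub_add_cancel, mul_sub, mul_smul_comm, assoc_of q (g_Ds_D q), one_mul] at h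
  rw [show (P + R - (s - 1) : ℤ) = P + R - s + 1 by ring] at h
  rw [bs_eq hq, smul_mul_assoc, mul_assoc, smul_comm, h, zpow_sub_one₀ hc]
  match_scalars <;> field_simp <;> ring

end coact

/-! ## Gaussian binomials and the explicit formula -/

/-- The number `(1 - x^n) / (1 - x)`. -/
def xNum (x : ℝ) (n : ℕ) : ℝ := (1 - x ^ n) / (1 - x)

/-- The Gaussian binomial coefficient, extended by `0`. -/
def gaussBinom (x : ℝ) (n k : ℕ) : ℝ := if k ≤ n then qBinomial x n k else 0

section scalars

variable {x : ℝ}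

theorem xNum_pos (hx0 : 0 ≤ x) (hx1 : x < 1) {n : ℕ} (hn : n ≠ 0) : 0 < xNum x n :=
  div_pos (sub_pos.2 (pow_lt_one₀ hx0 hx1 hn)) (sub_pos.2 hx1)

theorem qFactorial_zero : qFactorial x 0 = 1 := by simp [qFactorial]

theorem qFactorial_succ (n : ℕ) : qFactorial x (n + 1) = qFactorial x n * xNum x (n + 1) :=
  Finset.prod_range_succ _ _

theorem qFactorial_pos (hx0 : 0 ≤ x) (hx1 : x < 1) (n : ℕ) : 0 < qFactorial x n :=
  Finset.prod_pos fun _ _ => xNum_pos hx0 hx1 (Nat.succ_ne_zero _)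

theorem gaussBinom_add (m k : ℕ) :
    gaussBinom x (k + m) k = qFactorial x (k + m) / (qFactorial x k * qFactorial x m) := by
  simp [gaussBinom, qBinomial]

theorem gaussBinom_zero_right (hx0 : 0 ≤ x) (hx1 : x < 1) (n : ℕ) : gaussBinom x n 0 = 1 := by
  simp [gaussBinom, qBinomial, qFactorial_zero, (qFactorial_pos hx0 hx1 n).ne']

theorem gaussBinom_of_lt {n k : ℕ} (h : n < k) : gaussBinom x n k = 0 := by
  rw [gaussBinom, if_neg (by omega)]

/-- This version of the q-Pascal rule fits left multiplication by a column: the power of x comes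
from moving c past a^m, or d past b^m, together with y past x^m. -/
theorem gaussBinom_succ_succ (hx0 : 0 ≤ x) (hx1 : x < 1) (n k : ℕ) :
    gaussBinom x (n + 1) (k + 1) = gaussBinom x n k + x ^ (k + 1) * gaussBinom x n (k + 1) := by
  have hF := fun n => (qFactorial_pos hx0 hx1 n).ne'
  have hN := fun n => (xNum_pos hx0 hx1 (Nat.succ_ne_zero n)).ne'
  have h1 : 1 - x ≠ 0 := (sub_pos.2 hx1).ne'
  rcases lt_trichotomy n k with h | rfl | h
  · rw [gaussBinom_of_lt (by omega), gaussBinom_of_lt h, gaussBinom_of_lt (by omega)]; simp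
  · rw [gaussBinom_of_lt (Nat.lt_succ_self n)]
    have e1 := gaussBinom_add (x := x) 0 (n + 1)
    have e2 := gaussBinom_add (x := x) 0 n
    simp only [add_zero, qFactorial_zero] at e1 e2
    have := hF n
    have := hF (n + 1)
    rw [e1, e2]; field_simp; ring
  · obtain ⟨m, rfl⟩ := Nat.exists_eq_add_of_le h
    have e1 := gaussBinom_add (x := x) (m + 1) (k + 1)
    have e2 := gaussBinom_add (x := x) (m + 1) k
    have e3 := gaussBinom_add (x := x) m (k + 1)
    rw [show k + (m + 1) = k + 1 + m by ring] at e2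
    rw [show k + 1 + (m + 1) = k + 1 + m + 1 by ring] at e1
    have key : xNum x (k + 1 + m + 1) = xNum x (k + 1) + x ^ (k + 1) * xNum x (m + 1) := by
      simp only [xNum]; field_simp; ring
    have := hF k
    have := hF m
    have := hN k
    have := hN m
    rw [Nat.succ_eq_add_one, e1, e2, e3]
    simp only [qFactorial_succ (k + 1 + m), qFactorial_succ k, qFactorial_succ m] at *
    rw [key]
    simp only [Nat.succ_eq_add_one] at *
    field_simp

/-- The normalisation `√(|N+1| [s]! [M]! / ([P]! [R]!))`, up to a power of `x`, of the matrix
coefficient with row `(s, M)` and column `(P, R)`, where `N = P + R = s + M`. -/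
def normConst (x : ℝ) (P R s M : ℕ) : ℝ :=
  √(xNum x (P + R + 1) * (qFactorial x s * qFactorial x M) / (qFactorial x P * qFactorial x R))

theorem normConst_comm_left (P R s M : ℕ) : normConst x P R s M = normConst x R P s M := by
  rw [normConst, normConst, add_comm P R, mul_comm (qFactorial x P)]

theorem normConst_comm_right (P R s M : ℕ) : normConst x P R s M = normConst x P R M s := by
  rw [normConst, normConst, mul_comm (qFactorial x s)]

/-- `√([u] [v] / ([n] [n + 1]))` -/
def xRoot (x : ℝ) (u v n : ℕ) : ℝ :=
  √(xNum x u * xNum x v / (xNum x n * xNum x (n + 1)))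

/-- Passing to normalised elements turns the rational coefficient [s+1]/[N+1], N = P + R, into a
square root symmetric in row and column. This symmetry later makes the coefficients of a generator
and of its adjoint conjugate. -/
theorem normConst_succ (hx0 : 0 ≤ x) (hx1 : x < 1) (P R s M : ℕ) :
    xNum x (s + 1) / xNum x (P + R + 1) * normConst x P R s M =
      xRoot x (P + 1) (s + 1) (P + R + 1) * normConst x (P + 1) R (s + 1) M := by
  have hF := fun n => (qFactorial_pos hx0 hx1 n).ne'
  have hN := fun n => (xNum_pos hx0 hx1 (Nat.succ_ne_zero n))
  have h0 : 0 ≤ xNum x (s + 1) / xNum x (P + R + 1) := (div_pos (hN _) (hN _)).le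
  rw [normConst, normConst, xRoot, ← Real.sqrt_sq h0, ← Real.sqrt_mul (sq_nonneg _),
    ← Real.sqrt_mul (div_pos (mul_pos (hN _) (hN _)) (mul_pos (hN _) (hN _))).le]
  congr 1
  have := hF P; have := hF R; have := (hN P).ne'; have := (hN s).ne'
  have := (hN (P + R)).ne'; have := (hN (P + R + 1)).ne'
  rw [qFactorial_succ, qFactorial_succ, show P + 1 + R + 1 = P + R + 1 + 1 by ring]
  simp only [Nat.succ_eq_add_one] at *
  field_simp

theorem normConst_pred (hx0 : 0 ≤ x) (hx1 : x < 1) (P R s M : ℕ) :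
    xNum x (R + 1) / xNum x (P + R + 2) * normConst x P (R + 1) s (M + 1) =
      xRoot x (R + 1) (M + 1) (P + R + 1) * normConst x P R s M := by
  have hF := fun n => (qFactorial_pos hx0 hx1 n).ne'
  have hN := fun n => (xNum_pos hx0 hx1 (Nat.succ_ne_zero n))
  have h0 : 0 ≤ xNum x (R + 1) / xNum x (P + R + 2) := (div_pos (hN _) (hN _)).le
  rw [normConst, normConst, xRoot, ← Real.sqrt_sq h0, ← Real.sqrt_mul (sq_nonneg _),
    ← Real.sqrt_mul (div_pos (mul_pos (hN _) (hN _)) (mul_pos (hN _) (hN _))).le]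
  congr 1
  have := hF P; have := hF R; have := (hN R).ne'; have := (hN s).ne'
  have := (hN (P + R)).ne'; have := (hN (P + R + 1)).ne'
  rw [qFactorial_succ, qFactorial_succ, show P + (R + 1) + 1 = P + R + 1 + 1 by ring]
  simp only [Nat.succ_eq_add_one] at *
  field_simp

end scalars

/-! ### Expansion of the coefficients in ordered monomials. -/

section explicit

variable {q : ℂ}

theorem normSq_lt_one (hq1 : ‖q‖ < 1) : ‖q‖ ^ 2 < 1 := by nlinarith [norm_nonneg q]

theorem d_mul_b_pow (hq : q ≠ 0) (n : ℕ) :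
    polyD q * g q .b ^ n = conj q ^ n • (g q .b ^ n * polyD q) := by
  induction n with
  | zero => simp
  | succ n ih =>
    rw [pow_succ, ← mul_assoc, ih, smul_mul_assoc, mul_assoc, db_eq hq, mul_smul_comm, smul_smul,
      ← mul_assoc, pow_succ]

theorem c_mul_a_pow (n : ℕ) :
    polyC q * g q .a ^ n = conj q ^ n • (g q .a ^ n * polyC q) := by
  induction n with
  | zero => simp
  | succ n ih =>
    rw [pow_succ, ← mul_assoc, ih, smul_mul_assoc, mul_assoc, ca_eq, mul_smul_comm, smul_smul,
      ← mul_assoc, pow_succ]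

/-- The q-binomial theorem for (xb + yd)^R. From db = q̄ bd and yx = q xy one gets (yd)(xb) = |q|²
(xb)(yd), whence the base |q|². -/
theorem coact_zero_left (hq : q ≠ 0) (hq1 : ‖q‖ < 1) (R n : ℕ) : coact q 0 R n =
    (gaussBinom (‖q‖ ^ 2) R n : ℂ) • (g q .b ^ n * polyD q ^ (R - n)) := by
  have hx0 := sq_nonneg ‖q‖
  have hx1 := normSq_lt_one hq1
  induction R generalizing n with
  | zero =>
    rcases n with _ | n
    · simp [coact_zero_zero, gaussBinom_zero_right hx0 hx1]
    · rw [coact_eq_zero_of_lt _ _ (by push_cast; omega), gaussBinom_of_lt (Nat.succ_pos n)]; simp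
  | succ R ih =>
    rcases n with _ | n
    · have h := ih 0
      simp only [Nat.cast_zero] at h ⊢
      rw [coact_zero_succ, h, coact_eq_zero_of_neg _ _ (by omega), gaussBinom_zero_right hx0 hx1,
        gaussBinom_zero_right hx0 hx1]
      simp [pow_succ']
    · rw [coact_zero_succ, show ((n + 1 : ℕ) : ℤ) - 1 = n by push_cast; ring, ih, ih,
        gaussBinom_succ_succ hx0 hx1, mul_smul_comm, mul_smul_comm, ← mul_assoc, ← mul_assoc,
        d_mul_b_pow hq, smul_mul_assoc, mul_assoc (g q .b ^ (n + 1)), ← pow_succ',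
        ← pow_succ', Nat.add_sub_add_right]
      rcases lt_or_ge R (n + 1) with h | h
      · rw [gaussBinom_of_lt h]; simp
      · rw [show R - (n + 1) + 1 = R - n by omega]
        rw [zpow_natCast]
        push_cast
        rw [norm_sq_eq]
        match_scalars
        ring

theorem coact_eq_sum (hq : q ≠ 0) (hq1 : ‖q‖ < 1) (P R : ℕ) (s : ℤ) : coact q P R s =
    ∑ m ∈ Finset.range (P + 1), ((gaussBinom (‖q‖ ^ 2) P m : ℂ) * q ^ ((s - m) * (P - m))) •
      (g q .a ^ m * (polyC q ^ (P - m) * coact q 0 R (s - m))) := by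
  have hc := conj_ne_zero' hq
  have hx0 := sq_nonneg ‖q‖
  have hx1 := normSq_lt_one hq1
  induction P generalizing s with
  | zero => simp [gaussBinom_zero_right hx0 hx1]
  | succ P ih =>
    -- `B` collects the terms starting with yc. Moving c through a^m gives q̄^m, which combines with
    -- the power of q to |q|^{2m}, the weight in the Pascal rule.
    set B : ℕ → Poly q := fun m => (((‖q‖ ^ 2) ^ m * gaussBinom (‖q‖ ^ 2) P m : ℝ) *
      q ^ ((s - m) * ((P + 1 : ℕ) - m)) : ℂ) •
      (g q .a ^ m * (polyC q ^ (P + 1 - m) * coact q 0 R (s - m))) with hB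
    have e1 : g q .a * coact q P R (s - 1) = ∑ m ∈ Finset.range (P + 1),
        ((gaussBinom (‖q‖ ^ 2) P m : ℂ) *
          q ^ ((s - (m + 1 : ℕ)) * ((P + 1 : ℕ) - (m + 1 : ℕ)))) •
        (g q .a ^ (m + 1) * (polyC q ^ (P + 1 - (m + 1)) * coact q 0 R (s - (m + 1 : ℕ)))) := by
      rw [ih, Finset.mul_sum]
      refine Finset.sum_congr rfl fun m _ => ?_
      rw [mul_smul_comm, ← mul_assoc, ← pow_succ', Nat.add_sub_add_right,
        show s - 1 - (m : ℤ) = s - (m + 1 : ℕ) by push_cast; ring,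
        show ((P + 1 : ℕ) : ℤ) - (m + 1 : ℕ) = P - m by push_cast; ring]
    have e2 : q ^ s • (polyC q * coact q P R s) = ∑ m ∈ Finset.range (P + 1), B m := by
      rw [ih, Finset.mul_sum, Finset.smul_sum]
      refine Finset.sum_congr rfl fun m hm => ?_
      have hm' : P + 1 - m = P - m + 1 := by have := Finset.mem_range.1 hm; omega
      have hz : q ^ s * q ^ ((s - m) * (P - m)) * conj q ^ m =
          (q * conj q) ^ m * q ^ ((s - m) * ((P + 1 : ℕ) - m)) := by
        rw [show (s - m) * (((P + 1 : ℕ) : ℤ) - m) = s + (s - m) * (P - m) - m by push_cast; ring,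
          zpow_sub₀ hq, zpow_add₀ hq, mul_pow, zpow_natCast]
        field_simp
      simp only [hB, mul_smul_comm, ← mul_assoc (polyC q), c_mul_a_pow, smul_mul_assoc, smul_smul,
        hm', mul_assoc (g q .a ^ m), ← pow_succ']
      congr 1
      push_cast at hz ⊢
      rw [norm_sq_eq]
      linear_combination (gaussBinom (‖q‖ ^ 2) P m : ℂ) * hz
    -- This null term lets `B`, with its index shifted by one, be summed over the same range as the
    -- terms starting with xa.
    have e3 : B (P + 1) = 0 := by simp [hB, gaussBinom_of_lt (Nat.lt_succ_self P)]
    have e4 := Finset.sum_range_succ' B (P + 1)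
    rw [Finset.sum_range_succ, e3, add_zero] at e4
    rw [coact_succ_left, e1, e2, e4, Finset.sum_range_succ' _ (P + 1), ← add_assoc, ← Finset.sum_add_distrib]
    congr 1
    · refine Finset.sum_congr rfl fun m _ => ?_
      rw [hB, gaussBinom_succ_succ hx0 hx1, ← add_smul]
      congr 1
      push_cast
      ring
    · simp [hB, gaussBinom_zero_right hx0 hx1]

end explicit

/-! ## The action of the generators on the normalised elements -/

/-- `D` as a unit of `O(U_q(2))`. -/
def dUnit (q : ℂ) : (Poly q)ˣ := ⟨g q .D, g q .Ds, g_D_Ds q, g_Ds_D q⟩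

/-- The element `(D*)^k` for an integer `k`. -/
def dPow (q : ℂ) (k : ℤ) : Poly q := ((dUnit q ^ (-k) : (Poly q)ˣ) : Poly q)

/-- The normalised element of `O(U_q(2))` with row `(s, M) = (ℓ - i, ℓ + i)` and column
`(P, R) = (ℓ - j, ℓ + j)`. -/
def eNorm (q : ℂ) (P R s M : ℕ) (k : ℤ) : Poly q :=
  ((‖q‖ ^ (-(M : ℤ)) * normConst (‖q‖ ^ 2) P R s M : ℝ) : ℂ) • (coact q P R s * dPow q k)

section action

variable {q : ℂ}

theorem D_mul_dPow (k : ℤ) : g q .D * dPow q k = dPow q (k - 1) := by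
  rw [dPow, dPow, show -(k - 1) = 1 + -k by ring, zpow_add, zpow_one, Units.val_mul]; rfl

theorem Ds_mul_dPow (k : ℤ) : g q .Ds * dPow q k = dPow q (k + 1) := by
  rw [dPow, dPow, show -(k + 1) = -1 + -k by ring, zpow_add, zpow_neg_one, Units.val_mul]; rfl

theorem D_mul_coact_mul_dPow (hq : q ≠ 0) (P R : ℕ) (s k : ℤ) :
    g q .D * (coact q P R s * dPow q k) =
      (conj q / q) ^ (s - P) • (coact q P R s * dPow q (k - 1)) := by
  have h : g q .D * coact q P R s = (conj q / q) ^ (s - P) • (coact q P R s * g q .D) := by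
    rw [coact_mul_D hq, smul_smul, ← mul_zpow, div_mul_div_cancel₀ hq,
      div_self (conj_ne_zero' hq), one_zpow, one_smul]
  rw [← mul_assoc, h, smul_mul_assoc, mul_assoc, D_mul_dPow]

theorem Ds_mul_coact_mul_dPow (hq : q ≠ 0) (P R : ℕ) (s k : ℤ) :
    g q .Ds * (coact q P R s * dPow q k) =
      (q / conj q) ^ (s - P) • (coact q P R s * dPow q (k + 1)) := by
  have h : g q .Ds * coact q P R s = (q / conj q) ^ (s - P) • (coact q P R s * g q .Ds) := by
    rw [coact_mul_Ds hq, smul_smul, ← mul_zpow, div_mul_div_cancel₀ (conj_ne_zero' hq),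
      div_self hq, one_zpow, one_smul]
  rw [← mul_assoc, h, smul_mul_assoc, mul_assoc, Ds_mul_dPow]

theorem D_mul_eNorm (hq : q ≠ 0) (P R s M : ℕ) (k : ℤ) : g q .D * eNorm q P R s M k =
    (conj q / q) ^ ((s : ℤ) - P) • eNorm q P R s M (k - 1) := by
  rw [eNorm, mul_smul_comm, D_mul_coact_mul_dPow hq, smul_comm, eNorm]

theorem Ds_mul_eNorm (hq : q ≠ 0) (P R s M : ℕ) (k : ℤ) : g q .Ds * eNorm q P R s M k =
    (q / conj q) ^ ((s : ℤ) - P) • eNorm q P R s M (k + 1) := by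
  rw [eNorm, mul_smul_comm, Ds_mul_coact_mul_dPow hq, smul_comm, eNorm]

theorem qNum_eq_xNum (n : ℕ) : qNum q n = (xNum (‖q‖ ^ 2) n : ℂ) := by
  rw [qNum_natCast, xNum]; push_cast; rw [norm_sq_eq]

theorem xNum_zero (x : ℝ) : xNum x 0 = 0 := by simp [xNum]

theorem xRoot_zero_left (x : ℝ) (v n : ℕ) : xRoot x 0 v n = 0 := by simp [xRoot, xNum_zero]

theorem xRoot_zero_right (x : ℝ) (u n : ℕ) : xRoot x u 0 n = 0 := by simp [xRoot, xNum_zero]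

/-- The scalar identity behind the terms that raise `ℓ`. -/
theorem raise_const (hq1 : ‖q‖ < 1) (P R s M : ℕ) :
    xNum (‖q‖ ^ 2) (s + 1) * normConst (‖q‖ ^ 2) P R s M = xNum (‖q‖ ^ 2) (P + R + 1) *
      (xRoot (‖q‖ ^ 2) (P + 1) (s + 1) (P + R + 1) * normConst (‖q‖ ^ 2) (P + 1) R (s + 1) M) := by
  have h := normConst_succ (sq_nonneg ‖q‖) (normSq_lt_one hq1) P R s M
  have hn := (xNum_pos (sq_nonneg ‖q‖) (normSq_lt_one hq1) (Nat.succ_ne_zero (P + R))).ne'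
  rw [← h]; field_simp

/-- The scalar identity behind the terms that lower `ℓ`. -/
theorem lower_const (hq1 : ‖q‖ < 1) (P R s M : ℕ) :
    xNum (‖q‖ ^ 2) (R + 1) * normConst (‖q‖ ^ 2) P (R + 1) s (M + 1) =
      xNum (‖q‖ ^ 2) (P + R + 1 + 1) *
      (xRoot (‖q‖ ^ 2) (R + 1) (M + 1) (P + R + 1) * normConst (‖q‖ ^ 2) P R s M) := by
  have h := normConst_pred (sq_nonneg ‖q‖) (normSq_lt_one hq1) P R s M
  have hn := (xNum_pos (sq_nonneg ‖q‖) (normSq_lt_one hq1) (Nat.succ_ne_zero (P + R + 1))).ne'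
  rw [← h]; field_simp

theorem xNum_smul_cancel (hq1 : ‖q‖ < 1) (n : ℕ) {x y : Poly q}
    (h : (xNum (‖q‖ ^ 2) (n + 1) : ℂ) • x = (xNum (‖q‖ ^ 2) (n + 1) : ℂ) • y) : x = y := by
  have hn := (xNum_pos (sq_nonneg ‖q‖) (normSq_lt_one hq1) (Nat.succ_ne_zero n)).ne'
  exact (smul_right_injective _ (Complex.ofReal_ne_zero.2 hn)) h

theorem a_mul_eNorm (hq : q ≠ 0) (hq1 : ‖q‖ < 1) {P R s M : ℕ} (hN : P + R = s + M) (k : ℤ) :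
    g q .a * eNorm q P R s M k =
      (xRoot (‖q‖ ^ 2) (P + 1) (s + 1) (P + R + 1) : ℂ) • eNorm q (P + 1) R (s + 1) M k +
      (q ^ (P + 1) * conj q ^ (s + 1) * (‖q‖ : ℂ)⁻¹ * xRoot (‖q‖ ^ 2) R M (P + R)) •
        eNorm q P (R - 1) s (M - 1) (k - 1) := by
  have hc := conj_ne_zero' hq
  have hr : (‖q‖ : ℂ) ≠ 0 := by simpa using hq
  apply xNum_smul_cancel hq1 (P + R)
  have h := congrArg (· * dPow q k) (a_mul_coact hq hq1 P R s)
  rw [show ((P : ℤ) + R + 1) = (P + R + 1 : ℕ) by push_cast; ring,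
    show (s : ℤ) + 1 = (s + 1 : ℕ) by push_cast; ring] at h
  simp only [qNum_eq_xNum, add_mul, smul_mul_assoc, mul_assoc, D_mul_coact_mul_dPow hq] at h
  rw [eNorm, mul_smul_comm, smul_comm, h, smul_add, smul_add]
  congr 1
  · have h1 := congrArg (fun t : ℝ => (t : ℂ)) (raise_const hq1 P R s M)
    push_cast at h1
    simp only [eNorm, smul_smul]
    congr 1
    push_cast
    linear_combination (‖q‖ : ℂ) ^ (-(M : ℤ)) * h1
  -- For R = 0 or M = 0 there is no lowered vector, and the truncated indices on the right are
  -- meaningless. Both sides vanish: the root is 0, and so is [R] if R = 0 or the coefficient by its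
  -- support if M = 0.
  · rcases R with _ | R
    · simp [xNum_zero, xRoot_zero_left]
    rcases M with _ | M
    · rw [coact_eq_zero_of_lt _ _ (by push_cast; omega)]; simp [xRoot_zero_right]
    have h1 := congrArg (fun t : ℝ => (t : ℂ)) (lower_const hq1 P R s M)
    push_cast at h1
    simp only [add_tsub_cancel_right]
    simp only [eNorm, smul_smul]
    congr 1
    try simp only [← add_assoc]
    push_cast
    simp only [zpow_natCast, div_zpow, zpow_sub₀ hq, zpow_sub₀ hc, neg_add,
      zpow_add₀ hr, zpow_add₀ hq, zpow_neg, zpow_one]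
    field_simp
    linear_combination q ^ (P + 1) * conj q ^ (P + 1 + s) * h1

theorem b_mul_eNorm (hq : q ≠ 0) (hq1 : ‖q‖ < 1) {P R s M : ℕ} (hN : P + R = s + M) (k : ℤ) :
    g q .b * eNorm q P R s M k =
      (q ^ P * xRoot (‖q‖ ^ 2) (R + 1) (s + 1) (P + R + 1) : ℂ) • eNorm q P (R + 1) (s + 1) M k +
      (-(q ^ P * conj q ^ ((s : ℤ) - P + 1) * (‖q‖ : ℂ)⁻¹ * xRoot (‖q‖ ^ 2) P M (P + R))) •
        eNorm q (P - 1) R s (M - 1) (k - 1) := by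
  have hc := conj_ne_zero' hq
  have hr : (‖q‖ : ℂ) ≠ 0 := by simpa using hq
  apply xNum_smul_cancel hq1 (P + R)
  have h := congrArg (· * dPow q k) (b_mul_coact hq hq1 P R s)
  rw [show ((P : ℤ) + R + 1) = (P + R + 1 : ℕ) by push_cast; ring,
    show (s : ℤ) + 1 = (s + 1 : ℕ) by push_cast; ring] at h
  simp only [qNum_eq_xNum, sub_mul, smul_mul_assoc, mul_assoc, D_mul_coact_mul_dPow hq] at h
  rw [eNorm, mul_smul_comm, smul_comm, h, sub_eq_add_neg, smul_add, smul_neg, smul_add, ← neg_smul]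
  congr 1
  -- The scalar identities for b are those for a with the columns P and R exchanged. For a* both
  -- rows and columns are exchanged, for b* only the rows.
  · have h1 := congrArg (fun t : ℝ => (t : ℂ)) (raise_const hq1 R P s M)
    rw [normConst_comm_left R P, normConst_comm_left (R + 1) P, add_comm R P] at h1
    push_cast at h1
    simp only [eNorm, smul_smul]
    congr 1
    push_cast
    linear_combination (‖q‖ : ℂ) ^ (-(M : ℤ)) * q ^ P * h1
  · rcases P with _ | P
    · simp [xNum_zero, xRoot_zero_left]
    rcases M with _ | M
    · rw [coact_eq_zero_of_lt _ _ (by push_cast; omega)]; simp [xRoot_zero_right]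
    have h1 := congrArg (fun t : ℝ => (t : ℂ)) (lower_const hq1 R P s M)
    rw [normConst_comm_left R (P + 1), normConst_comm_left R P, add_comm R P] at h1
    push_cast at h1
    simp only [show P + 1 + R = P + R + 1 by ring]
    simp only [add_tsub_cancel_right]
    simp only [eNorm, smul_smul]
    congr 1
    try simp only [← add_assoc]
    push_cast
    simp only [zpow_natCast, div_zpow, zpow_sub₀ hq, zpow_sub₀ hc, neg_add,
      zpow_add₀ hr, zpow_add₀ hq, zpow_add₀ hc, zpow_neg, zpow_one]
    field_simp
    linear_combination -q ^ (P + 1) * h1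

theorem as_mul_eNorm (hq : q ≠ 0) (hq1 : ‖q‖ < 1) {P R s M : ℕ} (hN : P + R = s + M) (k : ℤ) :
    g q .as * eNorm q P R s M k =
      (q ^ s * conj q ^ P * ‖q‖ * xRoot (‖q‖ ^ 2) (R + 1) (M + 1) (P + R + 1) : ℂ) • eNorm q P (R + 1) s (M + 1) (k + 1) +
      (xRoot (‖q‖ ^ 2) P s (P + R) : ℂ) •
        eNorm q (P - 1) R (s - 1) M k := by
  have hc := conj_ne_zero' hq
  have hr : (‖q‖ : ℂ) ≠ 0 := by simpa using hq
  apply xNum_smul_cancel hq1 (P + R)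
  have h := congrArg (· * dPow q k) (as_mul_coact hq hq1 P R s)
  rw [show ((P : ℤ) + R - s + 1) = (M + 1 : ℕ) by push_cast; omega,
    show ((P : ℤ) + R + 1) = (P + R + 1 : ℕ) by push_cast; ring] at h
  simp only [qNum_eq_xNum, add_mul, smul_mul_assoc, mul_assoc, Ds_mul_coact_mul_dPow hq] at h
  rw [eNorm, mul_smul_comm, smul_comm, h, smul_add, smul_add]
  congr 1
  · have h1 := congrArg (fun t : ℝ => (t : ℂ)) (raise_const hq1 R P M s)
    rw [normConst_comm_left R P, normConst_comm_left (R + 1) P, add_comm R P,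
      normConst_comm_right P R M, normConst_comm_right P (R + 1) (M + 1)] at h1
    push_cast at h1
    simp only [eNorm, smul_smul]
    congr 1
    push_cast
    simp only [zpow_natCast, div_zpow, zpow_sub₀ hq, zpow_sub₀ hc, neg_add,
      zpow_add₀ hr, zpow_neg, zpow_one]
    field_simp
    linear_combination h1
  · rcases P with _ | P
    · simp [xNum_zero, xRoot_zero_left]
    rcases s with _ | s
    · rw [coact_eq_zero_of_neg _ _ (by simp)]; simp [xRoot_zero_right]
    have h1 := congrArg (fun t : ℝ => (t : ℂ)) (lower_const hq1 R P M s)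
    rw [normConst_comm_left R (P + 1), normConst_comm_left R P, add_comm R P,
      normConst_comm_right (P + 1), normConst_comm_right P R M] at h1
    push_cast at h1
    simp only [show P + 1 + R = P + R + 1 by ring]
    simp only [add_tsub_cancel_right]
    simp only [eNorm, smul_smul]
    rw [show ((s + 1 : ℕ) : ℤ) - 1 = s by push_cast; ring]
    congr 1
    try simp only [← add_assoc]
    push_cast
    linear_combination (‖q‖ : ℂ) ^ (-(M : ℤ)) * h1

theorem bs_mul_eNorm (hq : q ≠ 0) (hq1 : ‖q‖ < 1) {P R s M : ℕ} (hN : P + R = s + M) (k : ℤ) :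
    g q .bs * eNorm q P R s M k =
      (-(q ^ ((s : ℤ) - P - 1) * conj q ^ P * ‖q‖ * xRoot (‖q‖ ^ 2) (P + 1) (M + 1) (P + R + 1))) • eNorm q (P + 1) R s (M + 1) (k + 1) +
      (conj q ^ P * xRoot (‖q‖ ^ 2) R s (P + R) : ℂ) •
        eNorm q P (R - 1) (s - 1) M k := by
  have hc := conj_ne_zero' hq
  have hr : (‖q‖ : ℂ) ≠ 0 := by simpa using hq
  apply xNum_smul_cancel hq1 (P + R)
  have h := congrArg (· * dPow q k) (bs_mul_coact hq hq1 P R s)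
  rw [show ((P : ℤ) + R - s + 1) = (M + 1 : ℕ) by push_cast; omega,
    show ((P : ℤ) + R + 1) = (P + R + 1 : ℕ) by push_cast; ring] at h
  simp only [qNum_eq_xNum, add_mul, smul_mul_assoc, mul_assoc, Ds_mul_coact_mul_dPow hq] at h
  rw [eNorm, mul_smul_comm, smul_comm, h, smul_add, smul_add]
  congr 1
  · have h1 := congrArg (fun t : ℝ => (t : ℂ)) (raise_const hq1 P R M s)
    rw [normConst_comm_right P R M, normConst_comm_right (P + 1) R (M + 1)] at h1
    push_cast at h1
    simp only [eNorm, smul_smul]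
    congr 1
    push_cast
    simp only [zpow_natCast, div_zpow, zpow_sub₀ hq, zpow_sub₀ hc, neg_add,
      zpow_add₀ hc, zpow_add₀ hq, zpow_add₀ hr, zpow_neg, zpow_one]
    field_simp
    linear_combination -h1
  · rcases R with _ | R
    · simp [xNum_zero, xRoot_zero_left]
    rcases s with _ | s
    · rw [coact_eq_zero_of_neg _ _ (by simp)]; simp [xRoot_zero_right]
    have h1 := congrArg (fun t : ℝ => (t : ℂ)) (lower_const hq1 P R M s)
    rw [normConst_comm_right P (R + 1), normConst_comm_right P R M] at h1
    push_cast at h1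
    simp only [add_tsub_cancel_right]
    simp only [eNorm, smul_smul]
    rw [show ((s + 1 : ℕ) : ℤ) - 1 = s by push_cast; ring]
    congr 1
    try simp only [← add_assoc]
    push_cast
    linear_combination (‖q‖ : ℂ) ^ (-(M : ℤ)) * conj q ^ P * h1

end action

/-! ## The Haar state on the normalised elements -/

/-- An upper triangular two-dimensional representation of `O(U_q(2))`, on the letters. -/
def triLetter (q z w : ℂ) : Letter → Matrix (Fin 2) (Fin 2) ℂ
  | .a => !![z, 0; 0, q * z]
  | .as => !![z⁻¹, 0; 0, (q * z)⁻¹]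
  | .b => !![0, 1; 0, 0]
  | .bs => 0
  | .D => !![w, 0; 0, q / conj q * w]
  | .Ds => !![w⁻¹, 0; 0, (q / conj q * w)⁻¹]

/-- An upper triangular two-dimensional representation of `O(U_q(2))`. -/
def triRep {q z w : ℂ} (hq : q ≠ 0) (hz : z ≠ 0) (hw : w ≠ 0) :
    Poly q →ₐ[ℂ] Matrix (Fin 2) (Fin 2) ℂ :=
  RingQuot.liftAlgHom ℂ ⟨FreeAlgebra.lift ℂ (triLetter q z w), by
    -- The representation does not respect the involution: b* goes to 0 while b does not. Only the
    -- listed algebra relations matter, so z and w may be arbitrary nonzero numbers.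
    have hc := conj_ne_zero' hq
    intro x y hxy
    cases hxy <;>
      simp only [map_mul, map_add, map_smul, map_one, FreeAlgebra.lift_ι_apply, triLetter,
        norm_sq_eq] <;>
      ext i j <;> fin_cases i <;> fin_cases j <;>
      simp [Matrix.mul_apply, Fin.sum_univ_two, hz, hw] <;> field_simp⟩

/-- The algebra homomorphism `(id ⊗ ρ)Δ` for the triangular representation `ρ`. -/
def triShift {q z w : ℂ} (hq : q ≠ 0) (hz : z ≠ 0) (hw : w ≠ 0) :
    Poly q →ₐ[ℂ] Matrix (Fin 2) (Fin 2) (Poly q) :=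
  ((matrixEquivTensor (Fin 2) ℂ (Poly q)).symm : _ →ₐ[ℂ] _).comp
    ((Algebra.TensorProduct.map (AlgHom.id ℂ (Poly q)) (triRep hq hz hw)).comp (comul q))

/-! ### Images of the coefficients under (id ⊗ ρ)Δ for the triangular representation ρ. -/

section shift

variable {q z w : ℂ} (hq : q ≠ 0) (hz : z ≠ 0) (hw : w ≠ 0)

theorem triRep_g (x : Letter) : triRep hq hz hw (g q x) = triLetter q z w x := by
  simp [triRep, g]

theorem comul_g (x : Letter) : comul q (g q x) = comulLetter q x := by
  simp [comul, g]

/-- Apply ρ to the identity (h ⊗ id)Δ(x) = h(x) 1 and compare matrix entries. -/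
theorem haar_shift {h : CUq2 q →ₚ[ℂ] ℂ} (hh : IsHaarState q h) (x : Poly q) (i j : Fin 2) :
    restr q h (triShift hq hz hw x i j) =
      restr q h x * (1 : Matrix (Fin 2) (Fin 2) ℂ) i j := by
  have key : ∀ t : Poly q ⊗[ℂ] Poly q,
      restr q h ((matrixEquivTensor (Fin 2) ℂ (Poly q)).symm
        (Algebra.TensorProduct.map (AlgHom.id ℂ (Poly q)) (triRep hq hz hw) t) i j) =
      triRep hq hz hw (TensorProduct.lid ℂ (Poly q) ((restr q h).rTensor (Poly q) t)) i j := by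
    intro t
    induction t using TensorProduct.induction_on with
    | zero => simp
    | add t u ht hu => simp [ht, hu]
    | tmul x y =>
      simp only [Algebra.TensorProduct.map_tmul, AlgHom.id_apply, matrixEquivTensor_apply_symm,
        LinearMap.rTensor_tmul, TensorProduct.lid_tmul, map_smul, Matrix.smul_apply,
        Matrix.map_apply, smul_eq_mul, Algebra.algebraMap_eq_smul_one, mul_smul_comm, mul_one]
      ring
  have h1 := key (comul q x)
  rw [hh.left_invariant x, map_smul, map_one] at h1
  exact h1

theorem triShift_a : triShift hq hz hw (g q .a) =
    !![z • g q .a, 0; 0, (q * z) • g q .a] := by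
  ext i j
  fin_cases i <;> fin_cases j <;>
    simp [triShift, comul_g, comulLetter, triRep_g, triLetter, matrixEquivTensor_apply_symm,
      Algebra.algebraMap_eq_smul_one]

theorem triShift_b : triShift hq hz hw (g q .b) =
    !![(w / z) • g q .b, g q .a; 0, (w / (conj q * z)) • g q .b] := by
  have hc := conj_ne_zero' hq
  ext i j
  fin_cases i <;> fin_cases j <;>
    simp [triShift, comul_g, comulLetter, triRep_g, triLetter, matrixEquivTensor_apply_symm,
      Algebra.algebraMap_eq_smul_one] <;> match_scalars <;> field_simp

theorem triShift_D : triShift hq hz hw (g q .D) =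
    !![w • g q .D, 0; 0, (q / conj q * w) • g q .D] := by
  ext i j
  fin_cases i <;> fin_cases j <;>
    simp [triShift, comul_g, comulLetter, triRep_g, triLetter, matrixEquivTensor_apply_symm,
      Algebra.algebraMap_eq_smul_one]

theorem triShift_Ds : triShift hq hz hw (g q .Ds) =
    !![w⁻¹ • g q .Ds, 0; 0, (q / conj q * w)⁻¹ • g q .Ds] := by
  ext i j
  fin_cases i <;> fin_cases j <;>
    simp [triShift, comul_g, comulLetter, triRep_g, triLetter, matrixEquivTensor_apply_symm,
      Algebra.algebraMap_eq_smul_one]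

theorem triShift_as : triShift hq hz hw (g q .as) =
    !![z⁻¹ • g q .as, (-(conj q / w)) • g q .bs; 0, (q * z)⁻¹ • g q .as] := by
  have hc := conj_ne_zero' hq
  ext i j
  fin_cases i <;> fin_cases j <;>
    simp [triShift, comul_g, comulLetter, triRep_g, triLetter, matrixEquivTensor_apply_symm,
      Algebra.algebraMap_eq_smul_one] <;> match_scalars <;> field_simp

theorem triShift_bs : triShift hq hz hw (g q .bs) =
    !![(z / w) • g q .bs, 0; 0, (conj q * z / w) • g q .bs] := by
  have hc := conj_ne_zero' hq
  ext i j
  fin_cases i <;> fin_cases j <;>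
    simp [triShift, comul_g, comulLetter, triRep_g, triLetter, matrixEquivTensor_apply_symm,
      Algebra.algebraMap_eq_smul_one] <;> match_scalars <;> field_simp

theorem triShift_c : triShift hq hz hw (polyC q) =
    !![z • polyC q, 0; 0, (q * z) • polyC q] := by
  have hc := conj_ne_zero' hq
  rw [polyC, map_smul, map_mul, triShift_D, triShift_bs]
  ext i j
  fin_cases i <;> fin_cases j <;> simp [smul_smul] <;>
    match_scalars <;> field_simp

theorem triShift_d : triShift hq hz hw (polyD q) =
    !![(w / z) • polyD q, polyC q; 0, (w / (conj q * z)) • polyD q] := by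
  have hc := conj_ne_zero' hq
  rw [polyD, polyC, map_mul, triShift_D, triShift_as]
  ext i j
  fin_cases i <;> fin_cases j <;> simp [Matrix.mul_apply, Fin.sum_univ_two, smul_smul] <;>
    match_scalars <;> field_simp

theorem triShift_coact_lower (P R : ℕ) (s : ℤ) :
    triShift hq hz hw (coact q P R s) 1 0 = 0 := by
  induction P generalizing s with
  | zero =>
    induction R generalizing s with
    | zero => rw [coact_zero_zero]; split_ifs <;> simp
    | succ R ih =>
      rw [coact_zero_succ, map_add, map_smul, map_mul, map_mul, triShift_b, triShift_d]
      simp only [Matrix.add_apply, Matrix.smul_apply, Matrix.mul_apply, Fin.sum_univ_two, ih]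
      simp
  | succ P ih =>
    rw [coact_succ_left, map_add, map_smul, map_mul, map_mul, triShift_a, triShift_c]
    simp only [Matrix.add_apply, Matrix.smul_apply, Matrix.mul_apply, Fin.sum_univ_two, ih]
    simp

/-- The diagonal entry is multiplicative because the images are upper triangular. It scales the
column (a, c) by z and the column (b, d) by w/z. -/
theorem triShift_coact_zero_zero (P R : ℕ) (s : ℤ) : triShift hq hz hw (coact q P R s) 0 0 =
    (z ^ P * (w / z) ^ R) • coact q P R s := by
  induction P generalizing s with
  | zero =>
    induction R generalizing s with
    | zero => rw [coact_zero_zero]; split_ifs <;> simp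
    | succ R ih =>
      rw [coact_zero_succ, map_add, map_smul, map_mul, map_mul, triShift_b, triShift_d]
      simp only [Matrix.add_apply, Matrix.smul_apply, Matrix.mul_apply, Fin.sum_univ_two, ih,
        triShift_coact_lower]
      simp
      match_scalars <;> ring
  | succ P ih =>
    rw [coact_succ_left, map_add, map_smul, map_mul, map_mul, triShift_a, triShift_c]
    simp only [Matrix.add_apply, Matrix.smul_apply, Matrix.mul_apply, Fin.sum_univ_two, ih,
      triShift_coact_lower]
    simp
    match_scalars <;> ring

theorem triShift_coact_one_one (R : ℕ) (s : ℤ) : triShift hq hz hw (coact q 0 R s) 1 1 =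
    (w / (conj q * z)) ^ R • coact q 0 R s := by
  induction R generalizing s with
  | zero => rw [coact_zero_zero]; split_ifs <;> simp
  | succ R ih =>
    rw [coact_zero_succ, map_add, map_smul, map_mul, map_mul, triShift_b, triShift_d]
    simp only [Matrix.add_apply, Matrix.smul_apply, Matrix.mul_apply, Fin.sum_univ_two, ih]
    simp
    match_scalars <;> ring

/-- The corner entry is a twisted derivation that kills a and c and sends b to a, d to c. It
therefore replaces one of the R factors η by ξ, and the sum of the resulting weights is a multiple
of [R]. -/
theorem triShift_coact_zero_one (hq1 : ‖q‖ < 1) (P R : ℕ) (s : ℤ) :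
    triShift hq one_ne_zero one_ne_zero (coact q P R s) 0 1 =
      (conj q * (conj q ^ R)⁻¹ * qNum q R) • coact q (P + 1) (R - 1) s := by
  have hc := conj_ne_zero' hq
  have hp := one_sub_ne_zero hq1
  induction P generalizing s with
  | zero =>
    induction R generalizing s with
    | zero => rw [coact_zero_zero]; split_ifs <;> simp [qNum_zero]
    | succ R ih =>
      have h1 : qNum q R • (q • coact q 1 R s) = qNum q R •
          (g q .b * coact q 1 (R - 1) (s - 1) + q ^ s • (polyD q * coact q 1 (R - 1) s)) := by
        rcases R with _ | R
        · simp [qNum_zero]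
        · have h2 := coact_succ_right hq 1 R s
          rw [pow_one] at h2
          rw [h2, add_tsub_cancel_right]
      rw [coact_zero_succ, map_add, map_smul, map_mul, map_mul, triShift_b, triShift_d]
      simp only [Matrix.add_apply, Matrix.smul_apply, Matrix.mul_apply, Fin.sum_univ_two, ih,
        triShift_coact_one_one]
      have h2 := coact_succ_left (q := q) 0 R s
      simp only [zero_add] at h2 h1 ⊢
      simp only [add_tsub_cancel_right]
      simp
      have h3 : qNum q ((R : ℤ) + 1) = q * conj q * qNum q R + 1 := by
        simp only [qNum, zpow_add_one₀ (mul_ne_zero hq hc)]; field_simp; ring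
      rw [h3]
      linear_combination (norm := skip)
        (-(conj q * (conj q ^ R)⁻¹)) • h1 - ((conj q ^ R)⁻¹) • h2
      match_scalars <;> field_simp <;> ring
  | succ P ih =>
    rw [coact_succ_left, map_add, map_smul, map_mul, map_mul, triShift_a, triShift_c,
      coact_succ_left (P + 1)]
    simp only [Matrix.add_apply, Matrix.smul_apply, Matrix.mul_apply, Fin.sum_univ_two, ih]
    simp
    match_scalars <;> ring

theorem triShift_dPow (k : ℤ) : triShift hq hz hw (dPow q k) =
    !![w ^ (-k) • dPow q k, 0; 0, (q / conj q * w) ^ (-k) • dPow q k] := by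
  have hw' : q / conj q * w ≠ 0 := mul_ne_zero (div_ne_zero hq (conj_ne_zero' hq)) hw
  induction k using Int.induction_on with
  | zero =>
    ext i j
    fin_cases i <;> fin_cases j <;> simp [dPow]
  | succ k ih =>
    rw [← Ds_mul_dPow, map_mul, ih, triShift_Ds, neg_add, zpow_add₀ hw, zpow_add₀ hw',
      zpow_neg_one, zpow_neg_one]
    ext i j
    fin_cases i <;> fin_cases j <;> simp [smul_smul, mul_comm]
  | pred k ih =>
    rw [← D_mul_dPow, map_mul, ih, triShift_D, show -(-(k : ℤ) - 1) = -(-k) + 1 by ring,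
      zpow_add_one₀ hw, zpow_add_one₀ hw']
    ext i j
    fin_cases i <;> fin_cases j <;> simp [smul_smul, mul_comm]

end shift

/-! ### Vanishing of the Haar state on the nontrivial coefficients. -/

section haar

variable {q : ℂ} {h : CUq2 q →ₚ[ℂ] ℂ}

/-- The element is a nonzero multiple of the corner entry obtained from P and R + 1, and the corner
entry of the identity matrix is 0. -/
theorem restr_coact_succ_left (hq : q ≠ 0) (hq1 : ‖q‖ < 1) (hh : IsHaarState q h) (P R : ℕ)
    (s k : ℤ) : restr q h (coact q (P + 1) R s * dPow q k) = 0 := by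
  have hc := conj_ne_zero' hq
  have h1 := haar_shift hq one_ne_zero one_ne_zero hh (coact q P (R + 1) s * dPow q k) 0 1
  rw [map_mul, triShift_dPow, Matrix.mul_apply, Fin.sum_univ_two,
    triShift_coact_zero_one hq hq1] at h1
  simp only [add_tsub_cancel_right] at h1
  simp only [Matrix.of_apply, Matrix.cons_val_zero, Matrix.cons_val_one, mul_zero, zero_add,
    smul_mul_assoc, mul_smul_comm, map_smul, smul_eq_mul, mul_one, ne_eq, zero_ne_one,
    not_false_eq_true, Matrix.one_apply_ne, qNum_eq_xNum, Matrix.cons_val'] at h1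
  have hn := (xNum_pos (sq_nonneg ‖q‖) (normSq_lt_one hq1) (Nat.succ_ne_zero R)).ne'
  have hz : (q / conj q) ^ k ≠ 0 := zpow_ne_zero _ (div_ne_zero hq hc)
  rw [mul_eq_zero, mul_eq_zero] at h1
  have hK : conj q * (conj q ^ (R + 1))⁻¹ * (xNum (‖q‖ ^ 2) (R + 1) : ℂ) ≠ 0 :=
    mul_ne_zero (mul_ne_zero hc (inv_ne_zero (pow_ne_zero _ hc))) (Complex.ofReal_ne_zero.2 hn)
  simpa [hz, hK] using h1

/-- The diagonal entry multiplies the element by (w/z)^R w^{-k}, so h vanishes on it as soon as some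
choice of z, w makes this different from 1. The pair (1, 2) serves for R = 0, and (2, 1) for R ≠ 0.
-/
theorem restr_coact_zero_left (hq : q ≠ 0) (hh : IsHaarState q h) (R : ℕ)
    (s k : ℤ) (hRk : R ≠ 0 ∨ k ≠ 0) : restr q h (coact q 0 R s * dPow q k) = 0 := by
  have key : ∀ {z w : ℂ} (hz : z ≠ 0) (hw : w ≠ 0), (w / z) ^ R * w ^ (-k) ≠ 1 →
      restr q h (coact q 0 R s * dPow q k) = 0 := by
    intro z w hz hw hne
    have h1 := haar_shift hq hz hw hh (coact q 0 R s * dPow q k) 0 0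
    rw [map_mul, triShift_dPow, Matrix.mul_apply, Fin.sum_univ_two,
      triShift_coact_zero_zero] at h1
    simp only [Matrix.of_apply, Matrix.cons_val_zero, Matrix.cons_val_one, mul_zero, add_zero,
      smul_mul_assoc, mul_smul_comm, map_smul, smul_eq_mul, mul_one,
      Matrix.one_apply_eq, Matrix.cons_val', pow_zero, one_mul] at h1
    have h2 : ((w / z) ^ R * w ^ (-k) - 1) * restr q h (coact q 0 R s * dPow q k) = 0 := by
      linear_combination h1
    exact (mul_eq_zero.1 h2).resolve_left (sub_ne_zero.2 hne)
  rcases eq_or_ne R 0 with rfl | hR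
  · refine key (z := 1) (w := 2) one_ne_zero two_ne_zero ?_
    have hk : -k ≠ 0 := by simpa using hRk
    intro h0
    have h3 := congrArg norm h0
    rw [pow_zero, one_mul, norm_zpow, norm_one, Complex.norm_ofNat] at h3
    exact hk ((zpow_eq_one_iff_right₀ (by norm_num) (by norm_num)).1 h3)
  · refine key (z := 2) (w := 1) two_ne_zero one_ne_zero ?_
    intro h0
    have h3 := congrArg norm h0
    rw [one_zpow, mul_one, norm_pow, norm_one, norm_div, norm_one, Complex.norm_ofNat] at h3
    have h4 := (pow_eq_one_iff_of_nonneg (by norm_num) hR).1 h3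
    norm_num at h4

end haar

/-! ## The elements `e^ℓ_{i,j,k}` of `C(U_q(2))` -/

section elements

variable {q : ℂ}

theorem toC_g (x : Letter) : toC q (g q x) = toCLetter q x := by simp [toC, g]

theorem toC_polyC : toC q (polyC q) = cElem q := by simp [polyC, cElem, toC_g, toCLetter]

theorem toC_polyD : toC q (polyD q) = dElem q := by simp [polyD, dElem, toC_g, toCLetter]

theorem toC_dPow (k : ℤ) : toC q (dPow q k) = dStarPow q k := by
  rw [dStarPow]
  split_ifs with hk
  · lift k to ℕ using hk
    rw [dPow, zpow_neg, zpow_natCast, ← inv_pow, Units.val_pow_eq_pow_val, map_pow,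
      Int.toNat_natCast]
    exact congrArg (· ^ k) (toC_g .Ds)
  · obtain ⟨n, rfl⟩ : ∃ n : ℕ, k = -n := ⟨(-k).toNat, by omega⟩
    rw [dPow, neg_neg, zpow_natCast, Units.val_pow_eq_pow_val, map_pow, Int.toNat_natCast]
    exact congrArg (· ^ n) (toC_g .D)

theorem isIndex_iff (L I J : ℤ) : IsIndex L I J ↔ ∃ P R s M : ℕ, P + R = s + M ∧
    L = P + R ∧ I = M - s ∧ J = R - P := by
  simp only [IsIndex, abs_le]
  constructor
  · rintro ⟨⟨h1, h2⟩, ⟨h3, h4⟩, ⟨u, h5⟩, ⟨v, h6⟩⟩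
    exact ⟨v.toNat, (L - v).toNat, u.toNat, (L - u).toNat, by omega, by omega, by omega, by omega⟩
  · rintro ⟨P, R, s, M, h, rfl, rfl, rfl⟩
    exact ⟨by omega, by omega, ⟨s, by omega⟩, ⟨P, by omega⟩⟩

theorem matCoeff_eq (hq : q ≠ 0) (hq1 : ‖q‖ < 1) {P R s M : ℕ} (hN : P + R = s + M) :
    matCoeff q (P + R) (M - s) (R - P) =
      ((√(qBinomial (‖q‖ ^ 2) (P + R) R) / √(qBinomial (‖q‖ ^ 2) (P + R) M) : ℝ) : ℂ) •
        toC q (coact q P R s) := by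
  have hN' : (P : ℤ) + R = s + M := by exact_mod_cast hN
  rw [matCoeff, show (((P : ℤ) + R - (R - P)) / 2).toNat = P by omega,
    show (((P : ℤ) + R + (R - P)) / 2).toNat = R by omega,
    show (((P : ℤ) + R - (M - s)) / 2).toNat = s by omega,
    show (((P : ℤ) + R + (M - s)) / 2).toNat = M by omega,
    show ((P : ℤ) + R).toNat = P + R by omega]
  set ρ : ℝ := √(qBinomial (‖q‖ ^ 2) (P + R) R) / √(qBinomial (‖q‖ ^ 2) (P + R) M)
  set H : ℕ → CUq2 q := fun m => ((gaussBinom (‖q‖ ^ 2) P m : ℂ) *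
    q ^ (((s : ℤ) - m) * (P - m))) • (gA q ^ m * (cElem q ^ (P - m) *
      toC q (coact q 0 R (s - m)))) with hH
  have e1 : toC q (coact q P R s) = ∑ m ∈ Finset.range (P + 1), H m := by
    rw [coact_eq_sum hq hq1, map_sum]
    refine Finset.sum_congr rfl fun m _ => ?_
    rw [map_smul, map_mul, map_mul, map_pow, map_pow, toC_polyC, toC_g]
    rfl
  -- The q-binomial expansion runs over m ≤ P, the antidiagonal over m ≤ s. Both are extended to a
  -- common range: the Gaussian binomial vanishes for m > P, and the second-column coefficient for m
  -- > s.
  have e2 : ∑ m ∈ Finset.range (P + 1), H m = ∑ m ∈ Finset.range (s + P + 1), H m := by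
    refine Finset.sum_subset (Finset.range_mono (by omega)) fun m _ hm => ?_
    simp only [Finset.mem_range, not_lt] at hm
    rw [hH]
    simp only [gaussBinom_of_lt (Nat.lt_of_succ_le hm), Complex.ofReal_zero, zero_mul, zero_smul]
  have e3 : ∑ m ∈ Finset.range (s + 1), H m = ∑ m ∈ Finset.range (s + P + 1), H m := by
    refine Finset.sum_subset (Finset.range_mono (by omega)) fun m _ hm => ?_
    simp only [Finset.mem_range, not_lt] at hm
    rw [hH]
    simp only [coact_eq_zero_of_neg 0 R (show (s : ℤ) - m < 0 by omega), map_zero, mul_zero,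
      smul_zero]
  rw [e1, e2, ← e3, Finset.smul_sum, Finset.sum_filter,
    Finset.Nat.sum_antidiagonal_eq_sum_range_succ_mk]
  refine Finset.sum_congr rfl fun m hm => ?_
  have hm' : m ≤ s := by have := Finset.mem_range.1 hm; omega
  rw [hH]
  simp only [show (s : ℤ) - m = (s - m : ℕ) by omega, coact_zero_left hq hq1, map_smul, map_mul,
    map_pow, toC_polyD, toC_g, toCLetter, mul_smul_comm, smul_smul, mul_assoc]
  split_ifs with hc
  · simp only [show (P : ℤ) - m = (P - m : ℕ) by omega, gaussBinom, if_pos hc.1, if_pos hc.2]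
    congr 1
    rw [show (((s - m : ℕ) : ℤ) * ((P - m : ℕ) : ℤ)) = (((s - m) * (P - m) : ℕ) : ℤ) by push_cast; rfl,
      zpow_natCast]
    push_cast
    ring
  · rcases not_and_or.1 hc with h | h
    · rw [gaussBinom_of_lt (not_le.1 h)]; simp
    · rw [gaussBinom_of_lt (not_le.1 h)]; simp

theorem qNumber_eq {r : ℝ} (hr : 0 < r) (hr1 : r < 1) (n : ℕ) :
    qNumber r (n + 1) = (r ^ n)⁻¹ * xNum (r ^ 2) (n + 1) := by
  have h1 : 1 - r ^ 2 ≠ 0 := by nlinarith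
  have h2 : r - r⁻¹ ≠ 0 := by
    intro h
    have : r * (r - r⁻¹) = 0 := by rw [h, mul_zero]
    rw [mul_sub, mul_inv_cancel₀ hr.ne'] at this
    apply h1; linarith
  rw [qNumber, xNum, div_eq_iff h2, zpow_neg, zpow_add_one₀ hr.ne', zpow_natCast]
  field_simp
  ring

/-- The factor |q|^{-i} = |q|^{(s-M)/2} and the factor |q|^{-(P+R)/2} hidden in the symmetric number
|2ℓ+1| multiply to |q|^{-M}, since P + R = s + M. The factorials [P+R]! cancel between the two
binomials. -/
theorem eElem_const (hq : q ≠ 0) (hq1 : ‖q‖ < 1) {P R s M : ℕ} (hN : P + R = s + M) :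
    ‖q‖ ^ (-(((M : ℤ) - s : ℤ) : ℝ) / 2) * √(qNumber ‖q‖ ((P : ℤ) + R + 1)) *
      (√(qBinomial (‖q‖ ^ 2) (P + R) R) / √(qBinomial (‖q‖ ^ 2) (P + R) M)) =
    ‖q‖ ^ (-(M : ℤ)) * normConst (‖q‖ ^ 2) P R s M := by
  have hr : 0 < ‖q‖ := norm_pos_iff.2 hq
  have hF := qFactorial_pos (sq_nonneg ‖q‖) (normSq_lt_one hq1)
  have hX := (xNum_pos (sq_nonneg ‖q‖) (normSq_lt_one hq1) (Nat.succ_ne_zero (P + R)))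
  have hr1 : ‖q‖ ^ (-(((M : ℤ) - s : ℤ) : ℝ) / 2) = √(‖q‖ ^ ((s : ℤ) - M)) := by
    rw [Real.sqrt_eq_rpow, ← Real.rpow_intCast, ← Real.rpow_mul hr.le]
    congr 1; push_cast; ring
  have hr2 : ‖q‖ ^ (-(M : ℤ)) = √(‖q‖ ^ (-(M : ℤ)) * ‖q‖ ^ (-(M : ℤ))) :=
    (Real.sqrt_mul_self (zpow_pos hr _).le).symm
  have hB : ∀ k, 0 ≤ qBinomial (‖q‖ ^ 2) (P + R) k := fun k =>
    (div_pos (hF _) (mul_pos (hF _) (hF _))).le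
  have hK : qNumber ‖q‖ ((P : ℤ) + R + 1) =
      (‖q‖ ^ (P + R))⁻¹ * xNum (‖q‖ ^ 2) (P + R + 1) := by
    rw [← qNumber_eq hr hq1]; push_cast; rfl
  rw [hr1, hr2, normConst, ← Real.sqrt_div (hB _), hK, ← Real.sqrt_mul (by positivity),
    ← Real.sqrt_mul (by positivity), ← Real.sqrt_mul (by positivity), qBinomial, qBinomial,
    Nat.add_sub_cancel, show P + R - M = s by omega]
  congr 1
  have h1 := (hF P).ne'; have h2 := (hF R).ne'; have h3 := (hF s).ne'
  have h4 := (hF M).ne'; have h5 := (hF (P + R)).ne'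
  rw [show ‖q‖ ^ (P + R) = ‖q‖ ^ s * ‖q‖ ^ M by rw [hN, pow_add], zpow_sub₀ hr.ne', zpow_neg,
    zpow_natCast, zpow_natCast]
  field_simp

theorem eElem_eq (hq : q ≠ 0) (hq1 : ‖q‖ < 1) {P R s M : ℕ} (hN : P + R = s + M)
    {L I J : ℤ} (hL : L = P + R) (hI : I = M - s) (hJ : J = R - P) (k : ℤ) :
    eElem q L I J k = toC q (eNorm q P R s M k) := by
  rw [eElem, if_pos ((isIndex_iff L I J).2 ⟨P, R, s, M, hN, hL, hI, hJ⟩)]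
  subst hL hI hJ
  rw [matCoeff_eq hq hq1 hN, eNorm, map_smul, map_mul, toC_dPow, smul_mul_assoc, smul_smul,
    ← eElem_const hq hq1 hN, ← Complex.ofReal_mul]

end elements

/-! ### The action formulas in terms of ℓ, i, j. -/

section eElemAction

variable {q : ℂ}

theorem root_eq {u v w : ℤ} (hq1 : ‖q‖ < 1) (U V n : ℕ) (hu : u = 2 * U) (hv : v = 2 * V)
    (hw : w = 2 * n) : root q u v w = (xRoot (‖q‖ ^ 2) U V n : ℂ) := by
  have h1 : 1 - ‖q‖ ^ 2 ≠ 0 := (sub_pos.2 (normSq_lt_one hq1)).ne'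
  subst hu hv hw
  have hp : ∀ m : ℕ, ‖q‖ ^ (2 * (m : ℤ)) = (‖q‖ ^ 2) ^ m := fun m => by
    rw [zpow_mul, zpow_natCast]; norm_cast
  rw [root, xRoot, show 2 * (n : ℤ) + 2 = 2 * (n + 1 : ℕ) by push_cast; ring, hp, hp, hp, hp]
  congr 2
  simp only [xNum]
  field_simp

theorem eElem_of_not_isIndex {L I J : ℤ} (h : ¬ IsIndex L I J) (k : ℤ) :
    eElem q L I J k = 0 := if_neg h

theorem D_mul_eElem (hq : q ≠ 0) (hq1 : ‖q‖ < 1) {L I J : ℤ} (h : IsIndex L I J) (k : ℤ) :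
    gD q * eElem q L I J k = (q / conj q) ^ ((I - J) / 2) • eElem q L I J (k - 1) := by
  obtain ⟨P, R, s, M, hN, hL, hI, hJ⟩ := (isIndex_iff L I J).1 h
  rw [eElem_eq hq hq1 hN hL hI hJ, eElem_eq hq hq1 hN hL hI hJ, ← map_smul,
    show gD q = toC q (g q .D) from (toC_g .D).symm, ← map_mul, D_mul_eNorm hq,
    show (I - J) / 2 = -((s : ℤ) - P) by omega, zpow_neg, ← inv_zpow, inv_div]

theorem Ds_mul_eElem (hq : q ≠ 0) (hq1 : ‖q‖ < 1) {L I J : ℤ} (h : IsIndex L I J) (k : ℤ) :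
    star (gD q) * eElem q L I J k = (conj q / q) ^ ((I - J) / 2) • eElem q L I J (k + 1) := by
  obtain ⟨P, R, s, M, hN, hL, hI, hJ⟩ := (isIndex_iff L I J).1 h
  rw [eElem_eq hq hq1 hN hL hI hJ, eElem_eq hq hq1 hN hL hI hJ, ← map_smul,
    show star (gD q) = toC q (g q .Ds) from (toC_g .Ds).symm, ← map_mul, Ds_mul_eNorm hq,
    show (I - J) / 2 = -((s : ℤ) - P) by omega, zpow_neg, ← inv_zpow, inv_div]

theorem a_mul_eElem (hq : q ≠ 0) (hq1 : ‖q‖ < 1) {L I J : ℤ} (h : IsIndex L I J) (k : ℤ) :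
    gA q * eElem q L I J k = alphaPlus q L I J • eElem q (L + 1) (I - 1) (J - 1) k +
      alphaMinus q L I J • eElem q (L - 1) (I - 1) (J - 1) (k - 1) := by
  obtain ⟨P, R, s, M, hN, hL, hI, hJ⟩ := (isIndex_iff L I J).1 h
  rw [eElem_eq hq hq1 hN hL hI hJ, show gA q = toC q (g q .a) from (toC_g .a).symm, ← map_mul,
    a_mul_eNorm hq hq1 hN, map_add, map_smul, map_smul, alphaPlus, alphaMinus]
  congr 1
  · rw [root_eq hq1 (P + 1) (s + 1) (P + R + 1) (by push_cast; omega) (by push_cast; omega)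
      (by push_cast; omega), eElem_eq hq hq1 (P := P + 1) (R := R) (s := s + 1) (M := M)
      (by omega) (by push_cast; omega) (by push_cast; omega) (by push_cast; omega)]
  · rw [root_eq hq1 R M (P + R) (by omega) (by omega) (by push_cast; omega)]
    rcases R with _ | R
    · simp [xRoot_zero_left]
    rcases M with _ | M
    · simp [xRoot_zero_right]
    rw [eElem_eq hq hq1 (P := P) (R := R) (s := s) (M := M) (by omega) (by push_cast at *; omega)
      (by push_cast at *; omega) (by push_cast at *; omega), show (L - J) / 2 = (P : ℕ) by omega,
      show (L - I) / 2 + 1 = (s + 1 : ℕ) by push_cast; omega, zpow_natCast, zpow_natCast, phase]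
    congr 1
    ring

theorem b_mul_eElem (hq : q ≠ 0) (hq1 : ‖q‖ < 1) {L I J : ℤ} (h : IsIndex L I J) (k : ℤ) :
    gB q * eElem q L I J k = betaPlus q L I J • eElem q (L + 1) (I - 1) (J + 1) k +
      betaMinus q L I J • eElem q (L - 1) (I - 1) (J + 1) (k - 1) := by
  obtain ⟨P, R, s, M, hN, hL, hI, hJ⟩ := (isIndex_iff L I J).1 h
  rw [eElem_eq hq hq1 hN hL hI hJ, show gB q = toC q (g q .b) from (toC_g .b).symm, ← map_mul,
    b_mul_eNorm hq hq1 hN, map_add, map_smul, map_smul, betaPlus, betaMinus]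
  congr 1
  · rw [root_eq hq1 (R + 1) (s + 1) (P + R + 1) (by push_cast; omega) (by push_cast; omega)
      (by push_cast; omega), eElem_eq hq hq1 (P := P) (R := R + 1) (s := s + 1) (M := M)
      (by omega) (by push_cast; omega) (by push_cast; omega) (by push_cast; omega),
      show (L - J) / 2 = (P : ℕ) by omega, zpow_natCast]
  · rw [root_eq hq1 P M (P + R) (by omega) (by omega) (by push_cast; omega)]
    rcases P with _ | P
    · simp [xRoot_zero_left]
    rcases M with _ | M
    · simp [xRoot_zero_right]
    rw [eElem_eq hq hq1 (P := P) (R := R) (s := s) (M := M) (by omega) (by push_cast at *; omega)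
      (by push_cast at *; omega) (by push_cast at *; omega),
      show (L - J) / 2 - 1 = (P : ℕ) by push_cast at *; omega,
      show (J - I) / 2 + 1 = (s : ℤ) - (P + 1 : ℕ) + 1 by push_cast at *; omega, zpow_natCast, phase]
    congr 1
    ring

theorem as_mul_eElem (hq : q ≠ 0) (hq1 : ‖q‖ < 1) {L I J : ℤ} (h : IsIndex L I J) (k : ℤ) :
    star (gA q) * eElem q L I J k =
      alphaPlusStar q L I J • eElem q (L + 1) (I + 1) (J + 1) (k + 1) +
      alphaMinusStar q L I J • eElem q (L - 1) (I + 1) (J + 1) k := by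
  have hr : (‖q‖ : ℂ) ≠ 0 := by simpa using hq
  obtain ⟨P, R, s, M, hN, hL, hI, hJ⟩ := (isIndex_iff L I J).1 h
  rw [eElem_eq hq hq1 hN hL hI hJ, show star (gA q) = toC q (g q .as) from (toC_g .as).symm,
    ← map_mul, as_mul_eNorm hq hq1 hN, map_add, map_smul, map_smul, alphaPlusStar, alphaMinusStar]
  congr 1
  · rw [root_eq hq1 (R + 1) (M + 1) (P + R + 1) (by push_cast; omega) (by push_cast; omega)
      (by push_cast; omega), eElem_eq hq hq1 (P := P) (R := R + 1) (s := s) (M := M + 1)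
      (by omega) (by push_cast; omega) (by push_cast; omega) (by push_cast; omega),
      show (L - J) / 2 + 1 = (P + 1 : ℕ) by push_cast; omega,
      show (L - I) / 2 = (s : ℕ) by omega, zpow_natCast, zpow_natCast, phase]
    congr 1
    field_simp
    rw [norm_sq_eq]
    ring
  · rw [root_eq hq1 P s (P + R) (by omega) (by omega) (by push_cast; omega)]
    rcases P with _ | P
    · simp [xRoot_zero_left]
    rcases s with _ | s
    · simp [xRoot_zero_right]
    rw [eElem_eq hq hq1 (P := P) (R := R) (s := s) (M := M) (by omega) (by push_cast at *; omega)
      (by push_cast at *; omega) (by push_cast at *; omega)]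
    rfl

theorem bs_mul_eElem (hq : q ≠ 0) (hq1 : ‖q‖ < 1) {L I J : ℤ} (h : IsIndex L I J) (k : ℤ) :
    star (gB q) * eElem q L I J k =
      betaPlusStar q L I J • eElem q (L + 1) (I + 1) (J - 1) (k + 1) +
      betaMinusStar q L I J • eElem q (L - 1) (I + 1) (J - 1) k := by
  have hr : (‖q‖ : ℂ) ≠ 0 := by simpa using hq
  obtain ⟨P, R, s, M, hN, hL, hI, hJ⟩ := (isIndex_iff L I J).1 h
  rw [eElem_eq hq hq1 hN hL hI hJ, show star (gB q) = toC q (g q .bs) from (toC_g .bs).symm,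
    ← map_mul, bs_mul_eNorm hq hq1 hN, map_add, map_smul, map_smul, betaPlusStar, betaMinusStar]
  congr 1
  · rw [root_eq hq1 (P + 1) (M + 1) (P + R + 1) (by push_cast; omega) (by push_cast; omega)
      (by push_cast; omega), eElem_eq hq hq1 (P := P + 1) (R := R) (s := s) (M := M + 1)
      (by omega) (by push_cast; omega) (by push_cast; omega) (by push_cast; omega),
      show (L - J) / 2 + 1 = (P + 1 : ℕ) by push_cast; omega,
      show (J - I) / 2 - 1 = (s : ℤ) - P - 1 by omega, zpow_natCast, phase]
    congr 1
    field_simp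
    rw [norm_sq_eq]
    ring
  · rw [root_eq hq1 R s (P + R) (by omega) (by omega) (by push_cast; omega)]
    rcases R with _ | R
    · simp [xRoot_zero_left]
    rcases s with _ | s
    · simp [xRoot_zero_right]
    rw [eElem_eq hq hq1 (P := P) (R := R) (s := s) (M := M) (by omega) (by push_cast at *; omega)
      (by push_cast at *; omega) (by push_cast at *; omega), show (L - J) / 2 = (P : ℕ) by omega,
      zpow_natCast]
    rfl

end eElemAction

/-! ## Orthonormality -/

section orthonormal

variable {q : ℂ} {h : CUq2 q →ₚ[ℂ] ℂ}

/-- The sesquilinear form `(x, y) ↦ h(x* y)`. -/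
def haarInner (h : CUq2 q →ₚ[ℂ] ℂ) (x y : CUq2 q) : ℂ := h (star x * y)

theorem haarInner_add_left (x y t : CUq2 q) :
    haarInner h (x + y) t = haarInner h x t + haarInner h y t := by
  rw [haarInner, star_add, add_mul, map_add]; rfl

theorem haarInner_add_right (x y t : CUq2 q) :
    haarInner h x (y + t) = haarInner h x y + haarInner h x t := by
  rw [haarInner, mul_add, map_add]; rfl

theorem haarInner_smul_left (c : ℂ) (x y : CUq2 q) :
    haarInner h (c • x) y = conj c * haarInner h x y := by
  rw [haarInner, star_smul, smul_mul_assoc, map_smul]; rfl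

theorem haarInner_smul_right (c : ℂ) (x y : CUq2 q) :
    haarInner h x (c • y) = c * haarInner h x y := by
  rw [haarInner, mul_smul_comm, map_smul]; rfl

theorem haarInner_mul_left (x y t : CUq2 q) :
    haarInner h (x * y) t = haarInner h y (star x * t) := by
  rw [haarInner, star_mul, mul_assoc]; rfl

theorem haarInner_zero_left (y : CUq2 q) : haarInner h 0 y = 0 := by simp [haarInner]

open Classical in
/-- The expected value of `⟨e^ℓ_{i,j,k}, e^{ℓ'}_{i',j',k'}⟩`. -/
def eDelta (L I J k L' I' J' k' : ℤ) : ℂ :=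
  if IsIndex L I J ∧ L = L' ∧ I = I' ∧ J = J' ∧ k = k' then 1 else 0

/-- The vectors with `2ℓ = L` have the expected inner products with all vectors of the family. -/
def OrthoAt (h : CUq2 q →ₚ[ℂ] ℂ) (L : ℤ) : Prop :=
  ∀ I J k L' I' J' k' : ℤ, IsIndex L' I' J' →
    haarInner h (eElem q L I J k) (eElem q L' I' J' k') = eDelta L I J k L' I' J' k'

theorem haarInner_of_not_isIndex {L I J : ℤ} (hL : ¬ IsIndex L I J) (k L' I' J' k' : ℤ) :
    haarInner h (eElem q L I J k) (eElem q L' I' J' k') = eDelta L I J k L' I' J' k' := by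
  rw [eElem_of_not_isIndex hL, haarInner_zero_left, eDelta, if_neg (fun hh => hL hh.1)]

/-- Evaluate ⟨x e^ℓ, e'⟩ = ⟨e^ℓ, x* e'⟩ by the action formulas on both sides. All terms but
⟨e^{ℓ+1/2}, e'⟩ are known from spins ℓ and ℓ - ½, and its coefficient is nonzero. -/
theorem haarInner_raise (x : CUq2 q) (ε δ κ : ℤ) (Ap Am Bp Bm : ℤ → ℤ → ℤ → ℂ)
    (hx : ∀ L I J k, IsIndex L I J → x * eElem q L I J k =
      Ap L I J • eElem q (L + 1) (I + ε) (J + δ) (k + κ) +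
      Am L I J • eElem q (L - 1) (I + ε) (J + δ) (k + κ - 1))
    (hs : ∀ L I J k, IsIndex L I J → star x * eElem q L I J k =
      Bp L I J • eElem q (L + 1) (I - ε) (J - δ) (k - κ + 1) +
      Bm L I J • eElem q (L - 1) (I - ε) (J - δ) (k - κ))
    (hm : ∀ L I J, Bm (L + 1) (I + ε) (J + δ) = conj (Ap L I J))
    (hp : ∀ L I J, Bp (L - 1) (I + ε) (J + δ) = conj (Am L I J))
    {L : ℤ} (h0 : OrthoAt h L) (h1 : OrthoAt h (L - 1)) {I J : ℤ} (hi : IsIndex L I J)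
    (hne : Ap L I J ≠ 0) (hi' : IsIndex (L + 1) (I + ε) (J + δ)) (k : ℤ) {L' I' J' : ℤ} (k' : ℤ)
    (hi2 : IsIndex L' I' J') :
    haarInner h (eElem q (L + 1) (I + ε) (J + δ) (k + κ)) (eElem q L' I' J' k') =
      eDelta (L + 1) (I + ε) (J + δ) (k + κ) L' I' J' k' := by
  have hne' : conj (Ap L I J) ≠ 0 := (map_ne_zero _).2 hne
  have e1 := haarInner_mul_left (h := h) x (eElem q L I J k) (eElem q L' I' J' k')
  rw [hx _ _ _ _ hi, hs _ _ _ _ hi2, haarInner_add_left, haarInner_smul_left,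
    haarInner_smul_left, haarInner_add_right, haarInner_smul_right, haarInner_smul_right,
    h1 _ _ _ _ _ _ _ hi2] at e1
  -- The vectors occurring in x* e' may have inadmissible indices. They are 0, and so is the
  -- expected value.
  have e2 : ∀ I₂ J₂ k₂ L₂, haarInner h (eElem q L I J k) (eElem q L₂ I₂ J₂ k₂) =
      eDelta L I J k L₂ I₂ J₂ k₂ := by
    intro I₂ J₂ k₂ L₂
    by_cases h2 : IsIndex L₂ I₂ J₂
    · exact h0 _ _ _ _ _ _ _ h2
    · rw [eElem_of_not_isIndex h2, eDelta, if_neg]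
      · simp [haarInner]
      · rintro ⟨h3, rfl, rfl, rfl, -⟩
        exact h2 h3
  rw [e2, e2] at e1
  -- By the conjugacy of the coefficients the two contributions linking ℓ with ℓ - ½ cancel. The
  -- next identity rewrites the remaining one as the expected value.
  have e3 : Bp L' I' J' * eDelta L I J k (L' + 1) (I' - ε) (J' - δ) (k' - κ + 1) =
      conj (Am L I J) * eDelta (L - 1) (I + ε) (J + δ) (k + κ - 1) L' I' J' k' := by
    by_cases hc : L - 1 = L' ∧ I + ε = I' ∧ J + δ = J' ∧ k + κ - 1 = k'
    · obtain ⟨rfl, rfl, rfl, rfl⟩ := hc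
      rw [hp, eDelta, eDelta, if_pos ⟨hi, by ring, by ring, by ring, by ring⟩,
        if_pos ⟨hi2, rfl, rfl, rfl, rfl⟩]
    · rw [eDelta, eDelta, if_neg, if_neg, mul_zero, mul_zero]
      · exact fun hh => hc hh.2
      · rintro ⟨-, h4, h5, h6, h7⟩
        exact hc ⟨by omega, by omega, by omega, by omega⟩
  have e4 : Bm L' I' J' * eDelta L I J k (L' - 1) (I' - ε) (J' - δ) (k' - κ) =
      conj (Ap L I J) * eDelta (L + 1) (I + ε) (J + δ) (k + κ) L' I' J' k' := by
    by_cases hc : L + 1 = L' ∧ I + ε = I' ∧ J + δ = J' ∧ k + κ = k'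
    · obtain ⟨rfl, rfl, rfl, rfl⟩ := hc
      rw [hm, eDelta, eDelta, if_pos ⟨hi, by ring, by ring, by ring, by ring⟩,
        if_pos ⟨hi', rfl, rfl, rfl, rfl⟩]
    · rw [eDelta, eDelta, if_neg, if_neg, mul_zero, mul_zero]
      · exact fun hh => hc hh.2
      · rintro ⟨-, h4, h5, h6, h7⟩
        exact hc ⟨by omega, by omega, by omega, by omega⟩
  apply mul_left_cancel₀ hne'
  linear_combination e1 + e3 + e4

theorem root_conj (u v w : ℤ) : conj (root q u v w) = root q u v w := Complex.conj_ofReal _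

theorem phase_conj : conj (phase q) = conj q / ‖q‖ := by simp [phase]

theorem root_ne_zero (hq : q ≠ 0) (hq1 : ‖q‖ < 1) {u v w : ℤ} (hu : 0 < u) (hv : 0 < v)
    (hw : 0 < w) : root q u v w ≠ 0 := by
  have hp : ∀ {n : ℤ}, 0 < n → 0 < 1 - ‖q‖ ^ n := fun hn =>
    sub_pos.2 (zpow_lt_one₀ (norm_pos_iff.2 hq) hq1 hn)
  exact Complex.ofReal_ne_zero.2 (Real.sqrt_pos.2 (div_pos (mul_pos (hp hu) (hp hv))
    (mul_pos (hp hw) (hp (by omega))))).ne'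

/-- This identity and the three below check on the formulas that raising by a generator and lowering
by its adjoint have conjugate coefficients, and likewise with raising and lowering interchanged. -/
theorem alphaMinusStar_eq (L I J : ℤ) :
    alphaMinusStar q (L + 1) (I + -1) (J + -1) = conj (alphaPlus q L I J) := by
  rw [alphaMinusStar, alphaPlus, root_conj]
  congr 1 <;> ring

theorem alphaPlusStar_eq (hq : q ≠ 0) (L I J : ℤ) :
    alphaPlusStar q (L - 1) (I + -1) (J + -1) = conj (alphaMinus q L I J) := by
  have hc := conj_ne_zero' hq
  simp only [alphaPlusStar, alphaMinus, map_mul, root_conj, phase_conj, map_zpow₀,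
    Complex.conj_conj]
  rw [show L - 1 + (J + -1) + 2 = L + J by ring, show L - 1 + (I + -1) + 2 = L + I by ring,
    show 2 * (L - 1) + 2 = 2 * L by ring, show L - 1 - (I + -1) = L - I by ring,
    show L - 1 - (J + -1) = L - J by ring, phase, zpow_add_one₀ hq, zpow_add_one₀ hc]
  ring

theorem betaMinusStar_eq (L I J : ℤ) :
    betaMinusStar q (L + 1) (I + -1) (J + 1) = conj (betaPlus q L I J) := by
  simp only [betaMinusStar, betaPlus, map_mul, root_conj, map_zpow₀]
  rw [show L + 1 - (J + 1) = L - J by ring, show L + 1 + (J + 1) = L + J + 2 by ring,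
    show L + 1 - (I + -1) = L - I + 2 by ring, show 2 * (L + 1) = 2 * L + 2 by ring]

theorem betaPlusStar_eq (hq : q ≠ 0) (L I J : ℤ) :
    betaPlusStar q (L - 1) (I + -1) (J + 1) = conj (betaMinus q L I J) := by
  have hc := conj_ne_zero' hq
  simp only [betaPlusStar, betaMinus, map_mul, map_neg, root_conj, phase_conj, map_zpow₀,
    Complex.conj_conj]
  rw [show L - 1 - (J + 1) + 2 = L - J by ring, show L - 1 + (I + -1) + 2 = L + I by ring,
    show 2 * (L - 1) + 2 = 2 * L by ring,
    show (J + 1 - (I + -1)) / 2 - 1 = (J - I) / 2 by omega,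
    show (L - 1 - (J + 1)) / 2 + 1 = (L - J) / 2 - 1 + 1 by omega, phase, zpow_add_one₀ hq,
    zpow_add_one₀ hc]
  ring

theorem haar_eElem (hq : q ≠ 0) (hq1 : ‖q‖ < 1) (hh : IsHaarState q h) {P R s M : ℕ}
    (hN : P + R = s + M) (k : ℤ) : restr q h (eNorm q P R s M k) =
      if P = 0 ∧ R = 0 ∧ k = 0 then 1 else 0 := by
  rw [eNorm, map_smul]
  rcases P with _ | P
  · by_cases hRk : R = 0 ∧ k = 0
    · obtain ⟨rfl, rfl⟩ := hRk
      obtain ⟨rfl, rfl⟩ : s = 0 ∧ M = 0 := by omega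
      have h1 : restr q h 1 = 1 := by
        rw [restr, LinearMap.comp_apply, AlgHom.toLinearMap_apply, map_one]; exact hh.map_one
      have h2 : xNum (‖q‖ ^ 2) 1 = 1 := by
        rw [xNum, pow_one, div_self (sub_pos.2 (normSq_lt_one hq1)).ne']
      simp [coact_zero_zero, dPow, h1, normConst, h2, qFactorial_zero]
    · rw [restr_coact_zero_left hq hh _ _ _ (not_and_or.1 hRk), smul_zero, if_neg (by tauto)]
  · rw [restr_coact_succ_left hq hq1 hh, smul_zero, if_neg (by omega)]

theorem dPow_mul_eNorm (hq : q ≠ 0) (P R s M : ℕ) (j k : ℤ) : dPow q j * eNorm q P R s M k =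
    ((q / conj q) ^ ((s : ℤ) - P)) ^ j • eNorm q P R s M (k + j) := by
  have hc := conj_ne_zero' hq
  have hd : (q / conj q) ^ ((s : ℤ) - P) ≠ 0 := zpow_ne_zero _ (div_ne_zero hq hc)
  induction j using Int.induction_on with
  | zero => simp [dPow]
  | succ j ih =>
    rw [← Ds_mul_dPow, mul_assoc, ih, mul_smul_comm, Ds_mul_eNorm hq, smul_smul, zpow_add_one₀ hd,
      add_assoc]
  | pred j ih =>
    rw [← D_mul_dPow, mul_assoc, ih, mul_smul_comm, D_mul_eNorm hq, smul_smul, zpow_sub_one₀ hd,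
      ← inv_zpow, inv_div, add_sub_assoc]

theorem star_toC_dPow (k : ℤ) : star (toC q (dPow q k)) = toC q (dPow q (-k)) := by
  simp only [toC_dPow, dStarPow]
  rcases lt_trichotomy k 0 with hk | rfl | hk
  · rw [if_neg (by omega), if_pos (by omega), star_pow]
  · simp
  · rw [if_pos (by omega), if_neg (by omega), star_pow, star_star, neg_neg]

theorem isIndex_zero {I J : ℤ} (hi : IsIndex 0 I J) : I = 0 ∧ J = 0 :=
  ⟨abs_nonpos_iff.1 hi.1, abs_nonpos_iff.1 hi.2.1⟩

theorem eNorm_zero (hq1 : ‖q‖ < 1) (k : ℤ) : eNorm q 0 0 0 0 k = dPow q k := by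
  have h2 : xNum (‖q‖ ^ 2) 1 = 1 := by
    rw [xNum, pow_one, div_self (sub_pos.2 (normSq_lt_one hq1)).ne']
  simp [eNorm, coact_zero_zero, normConst, h2, qFactorial_zero]

/-- Spin-zero vectors are powers of D. Multiplying another vector by such a power only changes its k
and its phase, so the inner product is a value of h given by `haar_eElem`. -/
theorem orthoAt_zero (hq : q ≠ 0) (hq1 : ‖q‖ < 1) (hh : IsHaarState q h) : OrthoAt h 0 := by
  intro I J k L' I' J' k' hi'
  by_cases hi : IsIndex 0 I J
  · obtain ⟨rfl, rfl⟩ := isIndex_zero hi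
    obtain ⟨P, R, s, M, hN, hL, hI, hJ⟩ := (isIndex_iff _ _ _).1 hi'
    rw [eElem_eq hq hq1 (P := 0) (R := 0) (s := 0) (M := 0) rfl
      (L := 0) (I := 0) (J := 0) (by simp) (by simp) (by simp),
      eElem_eq hq hq1 hN hL hI hJ, eNorm_zero hq1, haarInner, star_toC_dPow, ← map_mul,
      dPow_mul_eNorm hq, map_smul]
    have h1 := haar_eElem hq hq1 hh hN (k' + -k)
    have h2 : h (toC q (eNorm q P R s M (k' + -k))) = restr q h (eNorm q P R s M (k' + -k)) := rfl
    rw [map_smul, h2, h1, eDelta]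
    by_cases hc : P = 0 ∧ R = 0 ∧ k' + -k = 0
    · obtain ⟨rfl, rfl, hk⟩ := hc
      obtain ⟨rfl, rfl⟩ : s = 0 ∧ M = 0 := by omega
      rw [if_pos ⟨rfl, rfl, hk⟩, if_pos ⟨hi, by omega, by omega, by omega, by omega⟩]
      simp
    · rw [if_neg hc, if_neg, smul_zero]
      rintro ⟨-, h3, h4, h5, h6⟩
      exact hc ⟨by omega, by omega, by omega⟩
  · exact haarInner_of_not_isIndex hi _ _ _ _ _

theorem orthoAt_succ (hq : q ≠ 0) (hq1 : ‖q‖ < 1) {L : ℤ} (hL : 0 ≤ L)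
    (h0 : OrthoAt h L) (h1 : OrthoAt h (L - 1)) : OrthoAt h (L + 1) := by
  intro I J k L' I' J' k' hi'
  by_cases hi : IsIndex (L + 1) I J
  swap
  · exact haarInner_of_not_isIndex hi _ _ _ _ _
  have hc := conj_ne_zero' hq
  have hph : phase q ≠ 0 := div_ne_zero hq (by simpa using hq)
  have hi0 := hi
  simp only [IsIndex, abs_le] at hi0
  obtain ⟨⟨b1, b2⟩, ⟨b3, b4⟩, ⟨u, b5⟩, ⟨v, b6⟩⟩ := hi0
  -- The generator must start from an admissible vector of spin one half less. The generator a does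
  -- this unless i or j is maximal. If both are maximal a* is used, if only i is b*, and if only j
  -- is b.
  rcases eq_or_ne I (L + 1) with hI | hI <;> rcases eq_or_ne J (L + 1) with hJ | hJ
  · have hi1 : IsIndex L (I - 1) (J - 1) := by
      simp only [IsIndex, abs_le]
      exact ⟨⟨by omega, by omega⟩, ⟨by omega, by omega⟩, ⟨u, by omega⟩, ⟨v, by omega⟩⟩
    have key := haarInner_raise (star (gA q)) 1 1 1 (alphaPlusStar q) (alphaMinusStar q)
      (alphaPlus q) (alphaMinus q)
      (fun L I J k hi => by rw [as_mul_eElem hq hq1 hi, add_sub_cancel_right])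
      (fun L I J k hi => by rw [star_star, a_mul_eElem hq hq1 hi, sub_add_cancel])
      (fun L I J => by
        have := congrArg conj (alphaPlusStar_eq hq (L + 1) (I + 1) (J + 1))
        simpa using this.symm)
      (fun L I J => by
        have := congrArg conj (alphaMinusStar_eq (q := q) (L - 1) (I + 1) (J + 1))
        simpa using this.symm)
      h0 h1 hi1
      (mul_ne_zero (mul_ne_zero (mul_ne_zero (zpow_ne_zero _ hq) (zpow_ne_zero _ hc)) hph)
        (root_ne_zero hq hq1 (by omega) (by omega) (by omega)))
      (by simpa using hi) (k - 1) k' hi'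
    simpa using key
  · have hi1 : IsIndex L (I - 1) (J + 1) := by
      simp only [IsIndex, abs_le]
      exact ⟨⟨by omega, by omega⟩, ⟨by omega, by omega⟩, ⟨u, by omega⟩, ⟨v - 1, by omega⟩⟩
    have key := haarInner_raise (star (gB q)) 1 (-1) 1 (betaPlusStar q) (betaMinusStar q)
      (betaPlus q) (betaMinus q)
      (fun L I J k hi => by rw [bs_mul_eElem hq hq1 hi, add_sub_cancel_right]; rfl)
      (fun L I J k hi => by
        rw [star_star, b_mul_eElem hq hq1 hi, sub_add_cancel, sub_neg_eq_add])
      (fun L I J => by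
        have := congrArg conj (betaPlusStar_eq hq (L + 1) (I + 1) (J + -1))
        simpa using this.symm)
      (fun L I J => by
        have := congrArg conj (betaMinusStar_eq (q := q) (L - 1) (I + 1) (J + -1))
        simpa using this.symm)
      h0 h1 hi1
      (mul_ne_zero (mul_ne_zero (mul_ne_zero (neg_ne_zero.2 (zpow_ne_zero _ hq))
        (zpow_ne_zero _ hc)) hph) (root_ne_zero hq hq1 (by omega) (by omega) (by omega)))
      (by simpa using hi) (k - 1) k' hi'
    simpa using key
  · have hi1 : IsIndex L (I + 1) (J - 1) := by
      simp only [IsIndex, abs_le]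
      exact ⟨⟨by omega, by omega⟩, ⟨by omega, by omega⟩, ⟨u - 1, by omega⟩, ⟨v, by omega⟩⟩
    have key := haarInner_raise (gB q) (-1) 1 0 (betaPlus q) (betaMinus q)
      (betaPlusStar q) (betaMinusStar q)
      (fun L I J k hi => by rw [b_mul_eElem hq hq1 hi, add_zero]; rfl)
      (fun L I J k hi => by rw [bs_mul_eElem hq hq1 hi, sub_zero, sub_neg_eq_add])
      betaMinusStar_eq (betaPlusStar_eq hq) h0 h1 hi1
      (mul_ne_zero (zpow_ne_zero _ hq) (root_ne_zero hq hq1 (by omega) (by omega) (by omega)))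
      (by simpa using hi) k k' hi'
    simpa using key
  · have hi1 : IsIndex L (I + 1) (J + 1) := by
      simp only [IsIndex, abs_le]
      exact ⟨⟨by omega, by omega⟩, ⟨by omega, by omega⟩, ⟨u - 1, by omega⟩, ⟨v - 1, by omega⟩⟩
    have key := haarInner_raise (gA q) (-1) (-1) 0 (alphaPlus q) (alphaMinus q)
      (alphaPlusStar q) (alphaMinusStar q)
      (fun L I J k hi => by rw [a_mul_eElem hq hq1 hi, add_zero]; rfl)
      (fun L I J k hi => by rw [as_mul_eElem hq hq1 hi, sub_zero, sub_neg_eq_add, sub_neg_eq_add])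
      alphaMinusStar_eq (alphaPlusStar_eq hq) h0 h1 hi1
      (root_ne_zero hq hq1 (by omega) (by omega) (by omega))
      (by simpa using hi) k k' hi'
    simpa using key

theorem orthoAt (hq : q ≠ 0) (hq1 : ‖q‖ < 1) (hh : IsHaarState q h) (L : ℤ) : OrthoAt h L := by
  have hneg : ∀ L : ℤ, L < 0 → OrthoAt h L := fun L hL I J k L' I' J' k' _ =>
    haarInner_of_not_isIndex (fun hi => by have := abs_nonneg I; have := hi.1; omega) _ _ _ _ _
  -- The recursion has depth two. It starts from spin 0 and the empty spin -½.
  have key : ∀ n : ℕ, OrthoAt h n ∧ OrthoAt h ((n : ℤ) - 1) := by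
    intro n
    induction n with
    | zero => exact ⟨orthoAt_zero hq hq1 hh, hneg _ (by omega)⟩
    | succ n ih =>
      push_cast
      exact ⟨orthoAt_succ hq hq1 (by omega) ih.1 ih.2, by simpa using ih.1⟩
  rcases lt_or_ge L 0 with hL | hL
  · exact hneg L hL
  · lift L to ℕ using hL
    exact (key L).1

end orthonormal

/-! ## Totality -/

section total

variable {q : ℂ}

theorem poly_induction {p : Poly q → Prop} (hs : ∀ c : ℂ, p (algebraMap ℂ (Poly q) c))
    (hg : ∀ x, p (g q x)) (hm : ∀ x y, p x → p y → p (x * y))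
    (ha : ∀ x y, p x → p y → p (x + y)) (x : Poly q) : p x := by
  obtain ⟨w, rfl⟩ := RingQuot.mkAlgHom_surjective ℂ (PolyRel q) x
  induction w using FreeAlgebra.induction with
  | grade0 c => rw [AlgHom.commutes]; exact hs c
  | grade1 x => exact hg x
  | mul x y hx hy => rw [map_mul]; exact hm _ _ hx hy
  | add x y hx hy => rw [map_add]; exact ha _ _ hx hy

/-- The presented algebra is used here without an involution. This closure property makes its image
contain the *-algebra generated by a, b, D, which is dense. -/
theorem star_toC (x : Poly q) : ∃ y, toC q y = star (toC q x) := by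
  induction x using poly_induction with
  | hs c =>
    exact ⟨algebraMap ℂ _ (conj c), by
      rw [AlgHom.commutes, AlgHom.commutes, Algebra.algebraMap_eq_smul_one,
        Algebra.algebraMap_eq_smul_one, star_smul, star_one]; rfl⟩
  | hg x =>
    rw [toC_g]
    cases x with
    | a => exact ⟨g q .as, toC_g _⟩
    | as => exact ⟨g q .a, by rw [toC_g]; exact (star_star _).symm⟩
    | b => exact ⟨g q .bs, toC_g _⟩
    | bs => exact ⟨g q .b, by rw [toC_g]; exact (star_star _).symm⟩
    | D => exact ⟨g q .Ds, toC_g _⟩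
    | Ds => exact ⟨g q .D, by rw [toC_g]; exact (star_star _).symm⟩
  | hm x y hx hy =>
    obtain ⟨x', hx⟩ := hx
    obtain ⟨y', hy⟩ := hy
    exact ⟨y' * x', by rw [map_mul, map_mul, star_mul, hx, hy]⟩
  | ha x y hx hy =>
    obtain ⟨x', hx⟩ := hx
    obtain ⟨y', hy⟩ := hy
    exact ⟨x' + y', by rw [map_add, map_add, star_add, hx, hy]⟩

theorem denseRange_toC : DenseRange (toC q) := by
  have key : ∀ x ∈ StarAlgebra.adjoin ℂ {bigA q, bigB q, bigD q},
      ∃ y, (toC q y : univSub q).1 = x := by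
    intro x hx
    induction hx using StarAlgebra.adjoin_induction with
    | mem x hx =>
      rcases hx with rfl | rfl | rfl
      · exact ⟨g q .a, by rw [toC_g]; rfl⟩
      · exact ⟨g q .b, by rw [toC_g]; rfl⟩
      · exact ⟨g q .D, by rw [toC_g]; rfl⟩
    | algebraMap c => exact ⟨algebraMap ℂ _ c, by rw [AlgHom.commutes]; rfl⟩
    | add x y _ _ hx hy =>
      obtain ⟨x', rfl⟩ := hx
      obtain ⟨y', rfl⟩ := hy
      exact ⟨x' + y', by rw [map_add]; rfl⟩
    | mul x y _ _ hx hy =>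
      obtain ⟨x', rfl⟩ := hx
      obtain ⟨y', rfl⟩ := hy
      exact ⟨x' * y', by rw [map_mul]; rfl⟩
    | star x _ hx =>
      obtain ⟨x', rfl⟩ := hx
      obtain ⟨y', hy⟩ := star_toC x'
      exact ⟨y', by rw [hy]; rfl⟩
  intro x
  have hx : (x : univSub q).1 ∈
      closure (StarAlgebra.adjoin ℂ {bigA q, bigB q, bigD q} : Set (Big q)) := (x : univSub q).2
  have h2 : (x : univSub q) ∈ closure (Set.range (toC q) : Set (univSub q)) := by
    refine closure_subtype.2 (closure_mono ?_ hx)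
    intro t ht
    obtain ⟨y, rfl⟩ := key t ht
    exact ⟨_, ⟨y, rfl⟩, rfl⟩
  exact h2

/-- The span of the normalised elements in `C(U_q(2))`. -/
def eSpan (q : ℂ) : Submodule ℂ (CUq2 q) :=
  Submodule.span ℂ (Set.range fun p : Index => eElem q p.1.1 p.1.2.1 p.1.2.2.1 p.1.2.2.2)

theorem eElem_mem_eSpan (L I J k : ℤ) : eElem q L I J k ∈ eSpan q := by
  by_cases h : IsIndex L I J
  · exact Submodule.subset_span ⟨⟨(L, I, J, k), h⟩, rfl⟩
  · rw [eElem_of_not_isIndex h]; exact zero_mem _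

/-- The action formulas show that each letter preserves the span, and letters generate the algebra.
Applied to e^0_{0,0,0} = 1, this puts the whole algebra inside the span. -/
theorem toC_mul_mem_eSpan (hq : q ≠ 0) (hq1 : ‖q‖ < 1) (x : Poly q) :
    ∀ y ∈ eSpan q, toC q x * y ∈ eSpan q := by
  induction x using poly_induction with
  | hs c =>
    intro y hy
    rw [AlgHom.commutes, ← Algebra.smul_def]
    exact Submodule.smul_mem _ _ hy
  | hg x =>
    intro y hy
    rw [toC_g]
    refine Submodule.span_induction ?_ ?_ ?_ ?_ hy
    · rintro _ ⟨⟨⟨L, I, J, k⟩, hi⟩, rfl⟩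
      have hm := eElem_mem_eSpan (q := q)
      cases x <;> simp only [toCLetter]
      · rw [a_mul_eElem hq hq1 hi]
        exact add_mem (Submodule.smul_mem _ _ (hm _ _ _ _)) (Submodule.smul_mem _ _ (hm _ _ _ _))
      · rw [as_mul_eElem hq hq1 hi]
        exact add_mem (Submodule.smul_mem _ _ (hm _ _ _ _)) (Submodule.smul_mem _ _ (hm _ _ _ _))
      · rw [b_mul_eElem hq hq1 hi]
        exact add_mem (Submodule.smul_mem _ _ (hm _ _ _ _)) (Submodule.smul_mem _ _ (hm _ _ _ _))
      · rw [bs_mul_eElem hq hq1 hi]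
        exact add_mem (Submodule.smul_mem _ _ (hm _ _ _ _)) (Submodule.smul_mem _ _ (hm _ _ _ _))
      · rw [D_mul_eElem hq hq1 hi]
        exact Submodule.smul_mem _ _ (hm _ _ _ _)
      · rw [Ds_mul_eElem hq hq1 hi]
        exact Submodule.smul_mem _ _ (hm _ _ _ _)
    · rw [mul_zero]; exact zero_mem _
    · intro x y _ _ hx hy
      rw [mul_add]; exact add_mem hx hy
    · intro c x _ hx
      rw [mul_smul_comm]; exact Submodule.smul_mem _ _ hx
  | hm x y hx hy =>
    intro t ht
    rw [map_mul, mul_assoc]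
    exact hx _ (hy _ ht)
  | ha x y hx hy =>
    intro t ht
    rw [map_add, add_mul]
    exact add_mem (hx _ ht) (hy _ ht)

theorem toC_mem_eSpan (hq : q ≠ 0) (hq1 : ‖q‖ < 1) (x : Poly q) : toC q x ∈ eSpan q := by
  have h1 : eElem q 0 0 0 0 = 1 := by
    rw [eElem_eq hq hq1 (P := 0) (R := 0) (s := 0) (M := 0) rfl (by simp) (by simp) (by simp),
      eNorm_zero hq1]
    simp [dPow]
  have h2 := toC_mul_mem_eSpan hq hq1 x _ (eElem_mem_eSpan 0 0 0 0)
  rwa [h1, mul_one] at h2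

end total

/-! ## The GNS space -/

section gns

variable {q : ℂ} (h : CUq2 q →ₚ[ℂ] ℂ)

/-- The canonical map `C(U_q(2)) → L²(h)`. -/
def toGNS : CUq2 q →ₗ[ℂ] h.GNS :=
  (UniformSpace.Completion.toComplₗᵢ (𝕜 := ℂ) (E := h.PreGNS)).toLinearMap ∘ₗ
    h.toPreGNS.toLinearMap

theorem eVec_eq (L I J k : ℤ) : eVec q h L I J k = toGNS h (eElem q L I J k) := rfl

theorem gns_toGNS (x y : CUq2 q) : h.gnsStarAlgHom x (toGNS h y) = toGNS h (x * y) :=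
  PositiveLinearMap.gnsNonUnitalStarAlgHom_apply_coe h

theorem inner_toGNS (x y : CUq2 q) : inner ℂ (toGNS h x) (toGNS h y) = haarInner h x y :=
  UniformSpace.Completion.inner_coe _ _

/-- The squared GNS norm of y - x is h((y - x)*(y - x)), and the positive functional h is
continuous. Density in the C*-norm thus passes to L²(h). -/
theorem continuous_toGNS : Continuous (toGNS h) := by
  have hc : Continuous h := map_continuous h
  refine continuous_iff_continuousAt.2 fun x => ?_
  rw [ContinuousAt, tendsto_iff_norm_sub_tendsto_zero]
  have hn : ∀ y, ‖toGNS h y - toGNS h x‖ = √(h (star (y - x) * (y - x))).re := by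
    intro y
    rw [← map_sub]
    exact (UniformSpace.Completion.norm_coe _).trans (h.preGNS_norm_def _)
  simp only [hn]
  have h2 : Continuous fun y => √(h (star (y - x) * (y - x))).re := by fun_prop
  simpa using h2.tendsto x

theorem denseRange_toGNS : DenseRange (toGNS h) :=
  UniformSpace.Completion.denseRange_coe.comp h.toPreGNS.surjective.denseRange
    (UniformSpace.Completion.continuous_coe _)

theorem eFamily_total (hq : q ≠ 0) (hq1 : ‖q‖ < 1) :
    (Submodule.span ℂ (Set.range (eFamily q h))).topologicalClosure = ⊤ := by
  have h1 : Submodule.span ℂ (Set.range (eFamily q h)) = (eSpan q).map (toGNS h) := by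
    rw [eSpan, Submodule.map_span, ← Set.range_comp]; rfl
  rw [← Submodule.dense_iff_topologicalClosure_eq_top, h1]
  refine ((denseRange_toGNS h).comp denseRange_toC (continuous_toGNS h)).mono ?_
  rintro _ ⟨x, rfl⟩
  exact ⟨_, toC_mem_eSpan hq hq1 x, rfl⟩

theorem eFamily_orthonormal (hq : q ≠ 0) (hq1 : ‖q‖ < 1) (hh : IsHaarState q h) :
    Orthonormal ℂ (eFamily q h) := by
  classical
  rw [orthonormal_iff_ite]
  rintro ⟨⟨L, I, J, k⟩, hi⟩ ⟨⟨L', I', J', k'⟩, hi'⟩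
  change inner ℂ (toGNS h (eElem q L I J k)) (toGNS h (eElem q L' I' J' k')) = _
  rw [inner_toGNS, orthoAt hq hq1 hh L I J k L' I' J' k' hi', eDelta]
  congr 1
  exact propext ⟨fun ⟨_, h1, h2, h3, h4⟩ => Subtype.ext (by simp [h1, h2, h3, h4]),
    fun h => by
      have := congrArg Subtype.val h
      simp only [Prod.mk.injEq] at this
      exact ⟨hi, this⟩⟩

end gns

end Uq2

end

theorem mainTheorem3 (q : ℂ) (hq0 : q ≠ 0) (hq1 : ‖q‖ < 1)
    (h : Uq2.CUq2 q →ₚ[ℂ] ℂ) (hh : Uq2.IsHaarState q h) :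
    (Orthonormal ℂ (Uq2.eFamily q h) ∧
      (Submodule.span ℂ (Set.range (Uq2.eFamily q h))).topologicalClosure = ⊤) ∧
    ∀ L I J k : ℤ, Uq2.IsIndex L I J →
      h.gnsStarAlgHom (Uq2.gD q) (Uq2.eVec q h L I J k) =
          (q / star q) ^ ((I - J) / 2) • Uq2.eVec q h L I J (k - 1) ∧
      h.gnsStarAlgHom (star (Uq2.gD q)) (Uq2.eVec q h L I J k) =
          (star q / q) ^ ((I - J) / 2) • Uq2.eVec q h L I J (k + 1) ∧
      h.gnsStarAlgHom (Uq2.gB q) (Uq2.eVec q h L I J k) =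
          Uq2.betaPlus q L I J • Uq2.eVec q h (L + 1) (I - 1) (J + 1) k +
          Uq2.betaMinus q L I J • Uq2.eVec q h (L - 1) (I - 1) (J + 1) (k - 1) ∧
      h.gnsStarAlgHom (star (Uq2.gB q)) (Uq2.eVec q h L I J k) =
          Uq2.betaPlusStar q L I J • Uq2.eVec q h (L + 1) (I + 1) (J - 1) (k + 1) +
          Uq2.betaMinusStar q L I J • Uq2.eVec q h (L - 1) (I + 1) (J - 1) k ∧
      h.gnsStarAlgHom (Uq2.gA q) (Uq2.eVec q h L I J k) =
          Uq2.alphaPlus q L I J • Uq2.eVec q h (L + 1) (I - 1) (J - 1) k +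
          Uq2.alphaMinus q L I J • Uq2.eVec q h (L - 1) (I - 1) (J - 1) (k - 1) ∧
      h.gnsStarAlgHom (star (Uq2.gA q)) (Uq2.eVec q h L I J k) =
          Uq2.alphaPlusStar q L I J • Uq2.eVec q h (L + 1) (I + 1) (J + 1) (k + 1) +
          Uq2.alphaMinusStar q L I J • Uq2.eVec q h (L - 1) (I + 1) (J + 1) k := by
  refine ⟨⟨Uq2.eFamily_orthonormal h hq0 hq1 hh, Uq2.eFamily_total h hq0 hq1⟩, ?_⟩
  intro L I J k hi
  -- The GNS representation acts by left multiplication on classes, so the identities in the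
  -- C*-algebra carry over to L²(h) directly.
  simp only [Uq2.eVec_eq, Uq2.gns_toGNS, ← map_smul, ← map_add]
  exact ⟨congrArg _ (Uq2.D_mul_eElem hq0 hq1 hi k), congrArg _ (Uq2.Ds_mul_eElem hq0 hq1 hi k),
    congrArg _ (Uq2.b_mul_eElem hq0 hq1 hi k), congrArg _ (Uq2.bs_mul_eElem hq0 hq1 hi k),
    congrArg _ (Uq2.a_mul_eElem hq0 hq1 hi k), congrArg _ (Uq2.as_mul_eElem hq0 hq1 hi k)⟩
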